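/- Let $m\ge 2$ and let $c_1,c_2:\mathbb{R}\to\mathbb{R}$ be smooth functions with $c_1(x)<c_2(x)$ for all $x$. Let $D=\{(x_1,x_2)\in\mathbb{R}^2 : c_1(x_2)<x_1<c_2(x_2)\}$, let $$X=\Big\{(x_1,x_2,y)\in\overline{D}\times\mathbb{R}^{m-1} : (x_1-c_1(x_2))(c_2(x_2)-x_1)-\sum_{j=1}^{m-1}y_j^2=0\Big\}\subset\mathbb{R}^{m+1},$$ an $m$-dimensional smooth submanifold without boundary, and let $f:X\to\mathbb{R}$, $f(x_1,x_2,y)=x_1$. Write $S(c)$ for the set of critical points of a smooth function $c$. A contour of $f$ is a connected component of a level set of $f$; it is critical if it contains a critical point of $f$. The Reeb space $R_f$ is the space of all contours of $f$ with the quotient topology from $X$. A graph (respectively, a graph with ends) is a connected $1$-dimensional cell complex, with the weak topology with respect to the closures of its cells, in which the closure of each $1$-cell (edge) is homeomorphic to $[-1,1]$ (respectively, to $[-1,1]$ or to the ray $[0,\infty)$); its $0$-cells are the vertices. Graphs may be finite or infinite, and an isomorphism is a homeomorphism that maps the vertex set onto the vertex set. Let $q_1,q_2\in\mathbb{R}$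 and suppose: * $(\mathbb{R}\setminus\{q_1,q_2\})\cap\big(c_1(S(c_1))\cup c_2(S(c_2))\big)$ is a discrete and closed subset of $\mathbb{R}\setminus\{q_1,q_2\}$, and $S(c_1)\cup S(c_2)\neq\emptyset$; * $c_1(t)\to q_1$ and $c_2(t)\to q_1$ as $t\to-\infty$, and $c_1(t)\to q_2$ and $c_2(t)\to q_2$ as $t\to+\infty$; * every connected component $K$ of $f^{-1}(q_1)$ or of $f^{-1}(q_2)$ has a compact connected neighbourhood $N_K$ in $X$ that is a union of contours of $f$ and such that $N_K\setminus K$ has only finitely many connected components and contains no critical contour of $f$; and the sets $N_K$ can be chosen mutually disjoint. Then $R_f$, with the critical contours as its vertices, is a graph with ends (the Reeb graph of $f$). It is isomorphic to some graph if and only if the following four conditions hold. 1. Either $S(c_2)$ is unbounded below or $c_2$ is strictly increasing on some interval $(-\infty,b]$; or $S(c_2)$ is bounded below, $c_2$ is not strictly increasing on any interval $(-\infty,b]$, and $S(c_1)$ is unbounded below. 2. Either $S(c_2)$ is unbounded above or $c_2$ is strictly decreasing on some interval $[b,\infty)$; or $S(c_2)$ is bounded above, $c_2$ is not strictly decreasing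 on any interval $[b,\infty)$, and $S(c_1)$ is unbounded above. 3. Either $S(c_1)$ is unbounded below or $-c_1$ is strictly increasing on some interval $(-\infty,b]$; or $S(c_1)$ is bounded below, $-c_1$ is not strictly increasing on any interval $(-\infty,b]$, and $S(c_2)$ is unbounded below. 4. Either $S(c_1)$ is unbounded above or $-c_1$ is strictly decreasing on some interval $[b,\infty)$; or $S(c_1)$ is bounded above, $-c_1$ is not strictly decreasing on any interval $[b,\infty)$, and $S(c_2)$ is unbounded above. -/

import Mathlib

open Set Filter Topology
open scoped ContDiff

namespace ReebStrip

section ReebSpace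

variable {X : Type*} [TopologicalSpace X]

/-- The contour of `f` through `x`: the connected component of `x` in its level set. -/
def contour (f : X → ℝ) (x : X) : Set X :=
  connectedComponentIn (f ⁻¹' {f x}) x

/-- Two points are equivalent if they lie in the same contour. -/
def contourSetoid (f : X → ℝ) : Setoid X :=
  Setoid.ker (contour f)

/-- The Reeb space of `f`: the space of all contours, with the quotient topology. -/
abbrev ReebSpace (f : X → ℝ) : Type _ :=
  Quotient (contourSetoid f)

/-- The points of the Reeb space given by the contours that contain a point of `S`. For `S` the
critical set of `f` these are the critical contours. -/
def contoursMeeting (f : X → ℝ) (S : Set X) : Set (ReebSpace f) :=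
  (fun x => (Quotient.mk (contourSetoid f) x : ReebSpace f)) '' S

/-- The neighbourhood condition at the levels `q₁` and `q₂`, for a function `f` with critical set
`S`: every connected component `K` of the level sets of `q₁` and `q₂` has a compact connected
neighbourhood `N K` that is a union of contours and for which `N K \ K` has only finitely many
connected components and contains no critical contour; and these neighbourhoods are mutually
disjoint. -/
def NeighbourhoodCondition (f : X → ℝ) (S : Set X) (q₁ q₂ : ℝ) : Prop :=
  ∃ N : Set X → Set X,
    (∀ K : Set X, (∃ x, (f x = q₁ ∨ f x = q₂) ∧ K = contour f x) →
      N K ∈ 𝓝ˢ K ∧ IsCompact (N K) ∧ IsConnected (N K) ∧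
      (∀ y ∈ N K, contour f y ⊆ N K) ∧
      {C : Set X | ∃ y ∈ N K \ K, C = connectedComponentIn (N K \ K) y}.Finite ∧
      Disjoint (N K \ K) S) ∧
    (∀ K K' : Set X, (∃ x, (f x = q₁ ∨ f x = q₂) ∧ K = contour f x) →
      (∃ x, (f x = q₁ ∨ f x = q₂) ∧ K' = contour f x) → K ≠ K' → Disjoint (N K) (N K'))

end ReebSpace

section Graphs

/-- The edges (open `1`-cells) of a space `Y` with vertex set (`0`-skeleton) `V`: the connected
components of the complement of `V`. -/
def edges {Y : Type*} [TopologicalSpace Y] (V : Set Y) : Set (Set Y) :=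
  {e | ∃ y ∈ Vᶜ, e = connectedComponentIn Vᶜ y}

/-- `Y` is a connected `1`-dimensional cell complex with vertex set `V`: it is Hausdorff, `V` is
closed and discrete, the components of the complement of `V` are open `1`-cells (and there is at
least one), and `Y` carries the weak topology with respect to the closures of its cells.
That the boundary of an edge lies in `V` is automatic, as an edge is closed in the complement
of `V`. -/
structure IsOneDimComplex (Y : Type*) [TopologicalSpace Y] (V : Set Y) : Prop where
  connected : ConnectedSpace Y
  hausdorff : T2Space Y
  isClosed_vertices : IsClosed V
  discrete_vertices : DiscreteTopology V
  edges_nonempty : (edges V).Nonempty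
  isOpen_edge : ∀ e ∈ edges V, IsOpen e
  edge_homeo : ∀ e ∈ edges V, Nonempty (e ≃ₜ ℝ)
  weak_topology : ∀ A : Set Y, (∀ e ∈ edges V, IsClosed (A ∩ closure e)) → IsClosed A

/-- A graph: the closure of each edge is homeomorphic to the closed interval `D¹`. -/
structure IsGraph (Y : Type*) [TopologicalSpace Y] (V : Set Y) : Prop
    extends IsOneDimComplex Y V where
  closure_edge : ∀ e ∈ edges V, Nonempty (closure e ≃ₜ Icc (-1 : ℝ) 1)

/-- A graph with ends: the closure of each edge is homeomorphic to the closed interval `D¹` or to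
the ray `[0, ∞)`. -/
structure IsGraphWithEnds (Y : Type*) [TopologicalSpace Y] (V : Set Y) : Prop
    extends IsOneDimComplex Y V where
  closure_edge : ∀ e ∈ edges V,
    Nonempty (closure e ≃ₜ Icc (-1 : ℝ) 1) ∨ Nonempty (closure e ≃ₜ Ici (0 : ℝ))

/-- The space `Y` with vertex set `V` is isomorphic to some (finite or infinite) graph: there is a
homeomorphism onto a graph that carries the vertex set onto the vertex set. -/
def IsIsomorphicToGraph (Y : Type) [TopologicalSpace Y] (V : Set Y) : Prop :=
  ∃ (Z : Type) (_ : TopologicalSpace Z) (W : Set Z),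
    IsGraph Z W ∧ ∃ φ : Y ≃ₜ Z, φ '' V = W

end Graphs

section CriticalPoints

/-- The tangent vectors at `p` of a submanifold `M` of a normed space, as the velocities of the
smooth curves in `M` through `p`. -/
def tangentVectors {E : Type*} [NormedAddCommGroup E] [NormedSpace ℝ E] (M : Set E) (p : E) :
    Set E :=
  {v | ∃ ε > (0 : ℝ), ∃ γ : ℝ → E, ContDiffOn ℝ ∞ γ (Ioo (-ε) ε) ∧
    (∀ s ∈ Ioo (-ε) ε, γ s ∈ M) ∧ γ 0 = p ∧ HasDerivAt γ v 0}

/-- The critical points of the restriction of `g` to the submanifold `M`: the points of `M` where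
the differential of `g` vanishes on the tangent space of `M`. -/
def criticalSetOn {E : Type*} [NormedAddCommGroup E] [NormedSpace ℝ E] (M : Set E) (g : E → ℝ) :
    Set M :=
  {p | ∀ v ∈ tangentVectors M (p : E), fderiv ℝ g (p : E) v = 0}

/-- The critical set of a smooth function on the line. -/
def criticalSet (c : ℝ → ℝ) : Set ℝ :=
  {s | deriv c s = 0}

end CriticalPoints

section Strip

/-- `ℝ^(m+1) = ℝ × ℝ × ℝ^(m-1)` (for `m ≥ 1`), with points `(x₁, x₂, y)`. Only its topology and its
smooth structure are used. -/
abbrev Ambient (m : ℕ) : Type :=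
  ℝ × ℝ × (Fin (m - 1) → ℝ)

/-- The region between the graphs of `c₁` and `c₂`. -/
def region (c₁ c₂ : ℝ → ℝ) : Set (ℝ × ℝ) :=
  {x | c₁ x.2 < x.1 ∧ x.1 < c₂ x.2}

/-- The `m`-dimensional submanifold `X_{m,c₁,c₂}` of `ℝ^(m+1)`. -/
def manifoldX (m : ℕ) (c₁ c₂ : ℝ → ℝ) : Set (Ambient m) :=
  {p | (p.1, p.2.1) ∈ closure (region c₁ c₂) ∧
    (p.1 - c₁ p.2.1) * (c₂ p.2.1 - p.1) - ∑ j, p.2.2 j ^ 2 = 0}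

/-- The canonical projection of `ℝ^(m+1)` to the first coordinate. -/
def proj (m : ℕ) (p : Ambient m) : ℝ :=
  p.1

/-- The restriction of the projection to `X_{m,c₁,c₂}`. -/
def projX (m : ℕ) (c₁ c₂ : ℝ → ℝ) (p : manifoldX m c₁ c₂) : ℝ :=
  proj m p

/-- The critical set of the restriction of the projection to `X_{m,c₁,c₂}`. -/
def critX (m : ℕ) (c₁ c₂ : ℝ → ℝ) : Set (manifoldX m c₁ c₂) :=
  criticalSetOn (manifoldX m c₁ c₂) (proj m)

/-- The critical values of `c₁` and `c₂`, as a subset of the line without `q₁` and `q₂`. -/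
def criticalValuesOff (c₁ c₂ : ℝ → ℝ) (q₁ q₂ : ℝ) : Set ({q₁, q₂}ᶜ : Set ℝ) :=
  Subtype.val ⁻¹' (c₁ '' criticalSet c₁ ∪ c₂ '' criticalSet c₂)

end Strip

end ReebStrip

/-!
The manifold is a family of spheres over the closed strip `c₁ x₂ ≤ x₁ ≤ c₂ x₂`, collapsed to points
over the boundary curves. Hence a contour of `f` lies over a component of a slice
`{x | c₁ x ≤ t ≤ c₂ x}`, and it is all of the preimage of this component: a direction in the fibres
gives a section over the strip, and sections in different directions meet over the ends of the
component. The critical contours lie over the components that contain a tangency, a point `x` with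
`c₁ x = t`, `c₁' x = 0` or with `c₂ x = t`, `c₂' x = 0`.

At the levels `q₁` and `q₂` by the neighbourhood condition, and at the other levels because the
slices are compact and the critical values discrete, each component has an isolating box. Hence the
level is a local homeomorphism on the Reeb space off the vertices, it maps each edge
homeomorphically onto an open interval, and the closure of an edge adds at most one vertex at each
end of this interval. The closure fails to be compact exactly if the edge runs to infinity along
`x₂ → ±∞`, while its level tends to `q₁` or `q₂`. Such an edge exists if and only if, near `±∞`,
neither curve has a critical point and the strip avoids the limiting level; and this is the failure
of one of the four conditions.
-/

namespace ReebStrip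

section Intervals

theorem nonempty_homeomorph_Icc {a b : ℝ} (h : a < b) :
    Nonempty (Icc a b ≃ₜ Icc (-1 : ℝ) 1) :=
  ⟨(iccHomeoI a b h).trans (iccHomeoI (-1 : ℝ) 1 (by norm_num)).symm⟩

theorem nonempty_homeomorph_Ioo {a b : ℝ} (h : a < b) : Nonempty (Ioo a b ≃ₜ ℝ) := by
  let φ : ℝ ≃ₜ ℝ := affineHomeomorph ((b - a) / 2) ((a + b) / 2) (by linarith)
  have hφ : φ '' Ioo (-1 : ℝ) 1 = Ioo a b := by
    rw [affineHomeomorph_image_Ioo _ _ _ _ (by linarith)]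
    congr 1 <;> ring
  exact ⟨(Homeomorph.setCongr hφ.symm).trans ((φ.image (Ioo (-1 : ℝ) 1)).symm.trans
    (orderIsoIooNegOneOne ℝ).toHomeomorph.symm)⟩

theorem nonempty_homeomorph_Ico {a b : ℝ} (h : a < b) : Nonempty (Ico a b ≃ₜ Ici (0 : ℝ)) := by
  let g : ℝ → ℝ := fun x => orderIsoIooNegOneOne ℝ x
  have hg : IsEmbedding g :=
    IsEmbedding.subtypeVal.comp (orderIsoIooNegOneOne ℝ).toHomeomorph.isEmbedding
  have hg1 : g 0 < 1 := (orderIsoIooNegOneOne ℝ 0).2.2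
  have hg_image : g '' Ici 0 = Ico (g 0) 1 := by
    rw [← image_image Subtype.val, OrderIso.image_Ici]
    ext x
    constructor
    · rintro ⟨⟨y, hy⟩, hy0, rfl⟩
      exact ⟨hy0, hy.2⟩
    · rintro ⟨hx0, hx1⟩
      exact ⟨⟨x, (orderIsoIooNegOneOne ℝ 0).2.1.trans_le hx0, hx1⟩, hx0, rfl⟩
  have hpos : 0 < (b - a) / (1 - g 0) := div_pos (sub_pos.2 h) (sub_pos.2 hg1)
  let φ : ℝ ≃ₜ ℝ := affineHomeomorph ((b - a) / (1 - g 0)) (a - (b - a) / (1 - g 0) * g 0) hpos.ne'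
  have hφ : φ '' Ico (g 0) 1 = Ico a b := by
    have : 1 - g 0 ≠ 0 := (sub_pos.2 hg1).ne'
    rw [affineHomeomorph_image_Ico _ _ _ _ hpos]
    congr 1 <;> field
  exact ⟨(Homeomorph.setCongr hφ.symm).trans ((φ.image (Ico (g 0) 1)).symm.trans
    ((Homeomorph.setCongr hg_image.symm).trans (hg.homeomorphImage (Ici 0)).symm))⟩

theorem nonempty_homeomorph_Ioc {a b : ℝ} (h : a < b) : Nonempty (Ioc a b ≃ₜ Ici (0 : ℝ)) := by
  have hneg : (Homeomorph.neg ℝ) '' Ioc a b = Ico (-b) (-a) := by simp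
  obtain ⟨ψ⟩ := nonempty_homeomorph_Ico (neg_lt_neg h)
  exact ⟨((Homeomorph.neg ℝ).image (Ioc a b)).trans ((Homeomorph.setCongr hneg).trans ψ)⟩

theorem exists_eq_Ioo_of_isOpen_of_isConnected {s : Set ℝ} (ho : IsOpen s) (hc : IsConnected s)
    (hb : Bornology.IsBounded s) : ∃ a b, a < b ∧ s = Ioo a b := by
  have hIoo : s = Ioo (sInf s) (sSup s) := by
    refine Subset.antisymm ?_ (hc.Ioo_csInf_csSup_subset hb.bddBelow hb.bddAbove)
    rw [← interior_Icc]
    exact ho.subset_interior_iff.2 (subset_Icc_csInf_csSup hb.bddBelow hb.bddAbove)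
  exact ⟨_, _, nonempty_Ioo.1 (hIoo ▸ hc.nonempty), hIoo⟩

end Intervals

section LocalHomeomorph

variable {X Z : Type*} [TopologicalSpace X] [TopologicalSpace Z]

theorem isOpen_image_of_isLocalHomeomorphOn {f : X → Z} {s O : Set X}
    (hf : IsLocalHomeomorphOn f s) (hO : IsOpen O) (hOs : O ⊆ s) : IsOpen (f '' O) := by
  rw [isOpen_iff_mem_nhds]
  rintro _ ⟨x, hx, rfl⟩
  rw [← hf.map_nhds_eq (hOs hx)]
  exact image_mem_map (hO.mem_nhds hx)

theorem exists_isPreconnected_injOn_of_isLocalHomeomorphOn [LocallyConnectedSpace Z] {f : X → Z}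
    {s : Set X} (hf : IsLocalHomeomorphOn f s) (hs : IsOpen s) {x : X} (hx : x ∈ s) :
    ∃ U, IsOpen U ∧ x ∈ U ∧ U ⊆ s ∧ IsPreconnected U ∧ InjOn f U := by
  obtain ⟨e, hxe, rfl⟩ := hf x hx
  have ho : IsOpen (e.target ∩ e.symm ⁻¹' s) := e.symm.isOpen_inter_preimage hs
  have hex : e x ∈ e.target ∩ e.symm ⁻¹' s :=
    ⟨e.map_source hxe, by rwa [mem_preimage, e.left_inv hxe]⟩
  obtain ⟨W, hW, hWo, hxW, hWc⟩ :=
    locallyConnectedSpace_iff_subsets_isOpen_isConnected.1 ‹_› _ _ (ho.mem_nhds hex)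
  have hWt : W ⊆ e.target := hW.trans inter_subset_left
  refine ⟨e.symm '' W, e.symm.isOpen_image_of_subset_source hWo hWt,
    ⟨e x, hxW, e.left_inv hxe⟩, ?_,
    hWc.isPreconnected.image _ (e.continuousOn_symm.mono hWt), ?_⟩
  · rintro _ ⟨z, hz, rfl⟩
    exact (hW hz).2
  · refine e.injOn.mono ?_
    rintro _ ⟨z, hz, rfl⟩
    exact e.map_target (hWt hz)

/-- The inverses of `f` on `U₁` and `U₂` are sections of `f` over intervals; as they agree at one
point, they agree on the intersection of these intervals. -/
theorem injOn_union_of_isLocalHomeomorph [T2Space X] {f : X → ℝ} (hf : IsLocalHomeomorph f)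
    {U₁ U₂ : Set X} (ho₁ : IsOpen U₁) (ho₂ : IsOpen U₂) (hc₁ : IsPreconnected U₁)
    (hc₂ : IsPreconnected U₂) (hi₁ : InjOn f U₁) (hi₂ : InjOn f U₂) (hne : (U₁ ∩ U₂).Nonempty) :
    InjOn f (U₁ ∪ U₂) := by
  obtain ⟨x, hx₁, hx₂⟩ := hne
  have : Nonempty X := ⟨x⟩
  have hsection : ∀ {U}, IsOpen U → InjOn f U → ContinuousOn (Function.invFunOn f U) (f '' U) :=
    fun hU hi => (hf.isOpenMap.domRestrict hU).continuousOn_image_of_leftInvOn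
      hi.leftInvOn_invFunOn
  have hpre : IsPreconnected (f '' U₁ ∩ f '' U₂) :=
    ((hc₁.image f hf.continuous.continuousOn).ordConnected.inter
      (hc₂.image f hf.continuous.continuousOn).ordConnected).isPreconnected
  have heq : EqOn (Function.invFunOn f U₁) (Function.invFunOn f U₂) (f '' U₁ ∩ f '' U₂) := by
    refine (T2Space.isSeparatedMap f).eqOn_of_comp_eqOn hf.isLocallyInjective hpre
      ((hsection ho₁ hi₁).mono inter_subset_left) ((hsection ho₂ hi₂).mono inter_subset_right)
      (fun t ht => (Function.invFunOn_eq ht.1).trans (Function.invFunOn_eq ht.2).symm)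
      ⟨⟨x, hx₁, rfl⟩, ⟨x, hx₂, rfl⟩⟩ ?_
    rw [hi₁.leftInvOn_invFunOn hx₁, hi₂.leftInvOn_invFunOn hx₂]
  have hcross : ∀ u₁ ∈ U₁, ∀ u₂ ∈ U₂, f u₁ = f u₂ → u₁ = u₂ := fun u₁ hu₁ u₂ hu₂ hu => by
    rw [← hi₁.leftInvOn_invFunOn hu₁, ← hi₂.leftInvOn_invFunOn hu₂, ← hu]
    exact heq ⟨⟨u₁, hu₁, rfl⟩, ⟨u₂, hu₂, hu.symm⟩⟩
  rintro u (hu | hu) v (hv | hv) huv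
  · exact hi₁ hu hv huv
  · exact hcross u hu v hv huv
  · exact (hcross v hv u hu huv.symm).symm
  · exact hi₂ hu hv huv

theorem injective_of_isLocalHomeomorph [T2Space X] [PreconnectedSpace X] {f : X → ℝ}
    (hf : IsLocalHomeomorph f) : Function.Injective f := by
  intro x y hxy
  obtain ⟨U, -, -, hi, hx, hy⟩ := isPreconnected_univ.induction₂
    (fun x y => ∃ U, IsOpen U ∧ IsPreconnected U ∧ InjOn f U ∧ x ∈ U ∧ y ∈ U)
    (fun x _ => by
      obtain ⟨U, ho, hx, -, hc, hi⟩ := exists_isPreconnected_injOn_of_isLocalHomeomorphOn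
        (isLocalHomeomorph_iff_isLocalHomeomorphOn_univ.1 hf) isOpen_univ (mem_univ x)
      rw [nhdsWithin_univ]
      filter_upwards [ho.mem_nhds hx] with y hy using ⟨U, ho, hc, hi, hx, hy⟩)
    (fun _ y _ _ _ _ ⟨U, ho, hc, hi, hx, hy⟩ ⟨W, ho', hc', hi', hy', hz⟩ =>
      ⟨U ∪ W, ho.union ho', hc.union y hy hy' hc',
        injOn_union_of_isLocalHomeomorph hf ho ho' hc hc' hi hi' ⟨y, hy, hy'⟩,
        Or.inl hx, Or.inr hz⟩)
    (fun _ _ _ _ ⟨U, ho, hc, hi, hx, hy⟩ => ⟨U, ho, hc, hi, hy, hx⟩) (mem_univ x) (mem_univ y)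
  exact hi hx hy hxy

end LocalHomeomorph

section Edges

variable {Y : Type*} [TopologicalSpace Y] {V e : Set Y}

theorem edge_subset_compl (he : e ∈ edges V) : e ⊆ Vᶜ := by
  obtain ⟨y, -, rfl⟩ := he
  exact connectedComponentIn_subset _ _

theorem isConnected_edge (he : e ∈ edges V) : IsConnected e := by
  obtain ⟨y, hy, rfl⟩ := he
  exact isConnected_connectedComponentIn_iff.2 hy

theorem connectedComponentIn_mem_edges {y : Y} (hy : y ∉ V) : connectedComponentIn Vᶜ y ∈ edges V :=
  ⟨y, hy, rfl⟩

theorem subset_edge {s : Set Y} (he : e ∈ edges V) (hs : IsPreconnected s) (hsV : s ⊆ Vᶜ)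
    (hne : (s ∩ e).Nonempty) : s ⊆ e := by
  obtain ⟨y, -, rfl⟩ := he
  obtain ⟨z, hz, hz'⟩ := hne
  rw [connectedComponentIn_eq hz']
  exact hs.subset_connectedComponentIn hz hsV

theorem closure_edge_diff_subset (he : e ∈ edges V) : closure e \ V ⊆ e := by
  have hsub : e ⊆ closure e \ V := fun y hy => ⟨subset_closure hy, edge_subset_compl he hy⟩
  exact subset_edge he ((isConnected_edge he).isPreconnected.subset_closure hsub sdiff_subset)
    (fun y hy => hy.2) ((isConnected_edge he).nonempty.mono fun y hy => ⟨hsub hy, hy⟩)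

theorem image_mem_edges {Z : Type*} [TopologicalSpace Z] (φ : Y ≃ₜ Z) (he : e ∈ edges V) :
    φ '' e ∈ edges (φ '' V) := by
  obtain ⟨y, hy, rfl⟩ := he
  rw [φ.image_connectedComponentIn hy, image_compl_eq φ.bijective]
  exact connectedComponentIn_mem_edges fun ⟨z, hz, hzy⟩ => hy (φ.injective hzy ▸ hz)

theorem IsGraph.isCompact_closure (h : IsGraph Y V) (he : e ∈ edges V) : IsCompact (closure e) := by
  obtain ⟨φ⟩ := h.closure_edge e he
  rw [isCompact_iff_compactSpace]
  exact φ.symm.compactSpace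

theorem IsGraphWithEnds.isGraph (h : IsGraphWithEnds Y V)
    (hc : ∀ e ∈ edges V, IsCompact (closure e)) : IsGraph Y V where
  toIsOneDimComplex := h.toIsOneDimComplex
  closure_edge e he := by
    refine (h.closure_edge e he).resolve_right fun ⟨φ⟩ => ?_
    have := isCompact_iff_compactSpace.1 (hc e he)
    exact not_bddAbove_Ici (0 : ℝ) (isCompact_iff_compactSpace.2 φ.compactSpace).bddAbove

theorem IsIsomorphicToGraph.isCompact_closure {Y : Type} [TopologicalSpace Y] {V e : Set Y}
    (h : IsIsomorphicToGraph Y V) (he : e ∈ edges V) : IsCompact (closure e) := by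
  obtain ⟨Z, _, W, hW, φ, rfl⟩ := h
  have := hW.isCompact_closure (image_mem_edges φ he)
  rw [← φ.image_closure] at this
  exact φ.isCompact_image.1 this

theorem IsGraphWithEnds.isIsomorphicToGraph_iff {Y : Type} [TopologicalSpace Y] {V : Set Y}
    (h : IsGraphWithEnds Y V) :
    IsIsomorphicToGraph Y V ↔ ∀ e ∈ edges V, IsCompact (closure e) :=
  ⟨fun hG _ he => hG.isCompact_closure he,
    fun hc => ⟨Y, _, V, h.isGraph hc, Homeomorph.refl Y, image_id V⟩⟩

end Edges

section LevelFunction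

variable {Y : Type*} [TopologicalSpace Y]

/-- `C` is a compact neighbourhood of `y` that meets both `V` and the level of `y` at most in `y`,
and that is open relative to the levels at distance less than `δ` from the level of `y`. -/
structure IsIsolatingBox (f : Y → ℝ) (V : Set Y) (y : Y) (C : Set Y) (δ : ℝ) : Prop where
  pos : 0 < δ
  isCompact : IsCompact C
  mem : y ∈ C
  inter_vertices_subset : C ∩ V ⊆ {y}
  inter_level_subset : C ∩ f ⁻¹' {f y} ⊆ {y}
  isOpen_inter : IsOpen (C ∩ f ⁻¹' Ioo (f y - δ) (f y + δ))

/-- A continuous function that parametrizes the edges of the pair `(Y, V)`: a local homeomorphism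
off `V`, all of whose points have arbitrarily small isolating boxes. -/
structure IsLevelFunction (f : Y → ℝ) (V : Set Y) : Prop where
  continuous : Continuous f
  isLocalHomeomorphOn : IsLocalHomeomorphOn f Vᶜ
  exists_box : ∀ y, ∀ O ∈ 𝓝 y, ∃ C ⊆ O, ∃ δ, IsIsolatingBox f V y C δ

variable {f : Y → ℝ} {V C e : Set Y} {y : Y} {δ : ℝ}

theorem IsIsolatingBox.mem_nhds (hB : IsIsolatingBox f V y C δ) :
    C ∩ f ⁻¹' Ioo (f y - δ) (f y + δ) ∈ 𝓝 y :=
  hB.isOpen_inter.mem_nhds ⟨hB.mem, by simp [hB.pos]⟩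

namespace IsLevelFunction

theorem eventually_notMem_vertices (h : IsLevelFunction f V) (y : Y) : ∀ᶠ z in 𝓝[≠] y, z ∉ V := by
  obtain ⟨C, -, δ, hB⟩ := h.exists_box y univ univ_mem
  rw [eventually_nhdsWithin_iff]
  filter_upwards [hB.mem_nhds] with z hz hzy hzV
  exact hzy (hB.inter_vertices_subset ⟨hz.1, hzV⟩)

theorem isClosed_vertices (h : IsLevelFunction f V) : IsClosed V := by
  rw [← isOpen_compl_iff, isOpen_iff_mem_nhds]
  intro y hy
  filter_upwards [eventually_nhdsWithin_iff.1 (h.eventually_notMem_vertices y)] with z hz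
  rcases eq_or_ne z y with rfl | hzy
  · exact hy
  · exact hz hzy

theorem discrete_vertices (h : IsLevelFunction f V) : DiscreteTopology V := by
  rw [discreteTopology_subtype_iff]
  intro y _
  rw [inf_principal_eq_bot]
  exact h.eventually_notMem_vertices y

theorem edges_nonempty [T1Space Y] [ConnectedSpace Y] [Nontrivial Y] (h : IsLevelFunction f V) :
    (edges V).Nonempty := by
  obtain ⟨y⟩ : Nonempty Y := inferInstance
  obtain ⟨w, hw⟩ := (h.eventually_notMem_vertices y).exists
  exact ⟨_, connectedComponentIn_mem_edges hw⟩

theorem isOpen_edge (h : IsLevelFunction f V) (he : e ∈ edges V) : IsOpen e := by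
  rw [isOpen_iff_mem_nhds]
  intro y hy
  obtain ⟨U, hU, hyU, hUV, hUc, -⟩ := exists_isPreconnected_injOn_of_isLocalHomeomorphOn
    h.isLocalHomeomorphOn h.isClosed_vertices.isOpen_compl (edge_subset_compl he hy)
  exact mem_of_superset (hU.mem_nhds hyU) (subset_edge he hUc hUV ⟨y, hyU, hy⟩)

theorem isOpen_image (h : IsLevelFunction f V) {O : Set Y} (hO : IsOpen O) (hOV : O ⊆ Vᶜ) :
    IsOpen (f '' O) :=
  isOpen_image_of_isLocalHomeomorphOn h.isLocalHomeomorphOn hO hOV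

theorem isLocalHomeomorph_domRestrict_edge (h : IsLevelFunction f V) (he : e ∈ edges V) :
    IsLocalHomeomorph (e.domRestrict f) := by
  rw [isLocalHomeomorph_iff_isLocalHomeomorphOn_univ]
  exact h.isLocalHomeomorphOn.comp (t := Vᶜ)
    (isLocalHomeomorph_iff_isLocalHomeomorphOn_univ.1
      (h.isOpen_edge he).isOpenEmbedding_subtypeVal.isLocalHomeomorph)
    fun y _ => edge_subset_compl he y.2

theorem ordConnected_image_edge (h : IsLevelFunction f V) (he : e ∈ edges V) :
    (f '' e).OrdConnected :=
  ((isConnected_edge he).isPreconnected.image f h.continuous.continuousOn).ordConnected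

theorem ordConnected_image_closure_edge (h : IsLevelFunction f V) (he : e ∈ edges V) :
    (f '' closure e).OrdConnected :=
  ((isConnected_edge he).isPreconnected.closure.image f h.continuous.continuousOn).ordConnected

theorem finite_inter_level (h : IsLevelFunction f V) (hC : IsCompact C) {s : ℝ}
    (hd : Disjoint (C ∩ f ⁻¹' {s}) V) : (C ∩ f ⁻¹' {s}).Finite := by
  refine (hC.inter_right (isClosed_singleton.preimage h.continuous)).finite ?_
  rw [isDiscrete_iff_discreteTopology, discreteTopology_subtype_iff']
  intro y hy
  obtain ⟨U, hU, hyU, -, -, hinj⟩ := exists_isPreconnected_injOn_of_isLocalHomeomorphOn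
    h.isLocalHomeomorphOn h.isClosed_vertices.isOpen_compl (disjoint_left.1 hd hy)
  refine ⟨U, hU, Subset.antisymm ?_ (by simpa using ⟨hyU, hy⟩)⟩
  rintro z ⟨hz, hz'⟩
  exact hinj hz hyU (hz'.2.trans hy.2.symm)

theorem exists_image_edge_eq_Ioo (h : IsLevelFunction f V) (hb : Bornology.IsBounded (range f))
    (he : e ∈ edges V) :
    ∃ a b, a < b ∧ f '' e = Ioo a b :=
  exists_eq_Ioo_of_isOpen_of_isConnected (h.isOpen_image (h.isOpen_edge he) (edge_subset_compl he))
    ((isConnected_edge he).image f h.continuous.continuousOn) (hb.subset (image_subset_range f e))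

theorem subset_image_edge_inter (h : IsLevelFunction f V) (he : e ∈ edges V)
    (hB : IsIsolatingBox f V y C δ) {J : Set ℝ} (hJo : IsOpen J) (hJ : J.OrdConnected)
    (hJδ : J ⊆ Ioo (f y - δ) (f y + δ)) (hJy : f y ∉ J) (hne : (e ∩ C ∩ f ⁻¹' J).Nonempty) :
    J ⊆ f '' (e ∩ C) := by
  set D := e ∩ (C ∩ f ⁻¹' Ioo (f y - δ) (f y + δ)) ∩ f ⁻¹' J
  have hopen : IsOpen (f '' D) :=
    h.isOpen_image (((h.isOpen_edge he).inter hB.isOpen_inter).inter (hJo.preimage h.continuous))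
      fun z hz => edge_subset_compl he hz.1.1
  have hDsub : D ⊆ e ∩ C := fun z hz => ⟨hz.1.1, hz.1.2.1⟩
  have hclosed : IsClosed (f '' (closure e ∩ C)) :=
    ((hB.isCompact.inter_left isClosed_closure).image h.continuous).isClosed
  refine (hJ.isPreconnected.subset_of_closure_inter_subset hopen ?_ ?_).trans (image_mono hDsub)
  · obtain ⟨z, ⟨hz, hzC⟩, hzJ⟩ := hne
    exact ⟨f z, hzJ, z, ⟨⟨hz, hzC, hJδ hzJ⟩, hzJ⟩, rfl⟩
  · rintro s ⟨hs, hsJ⟩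
    obtain ⟨v, ⟨hve, hvC⟩, rfl⟩ := hclosed.closure_subset_iff.2
      (image_mono (hDsub.trans (inter_subset_inter_left C subset_closure))) hs
    have hvV : v ∉ V := fun hvV => hJy (hB.inter_vertices_subset ⟨hvC, hvV⟩ ▸ hsJ)
    exact ⟨v, ⟨⟨closure_edge_diff_subset he ⟨hve, hvV⟩, hvC, hJδ hsJ⟩, hsJ⟩, rfl⟩

theorem exists_mem_edge_half_level (h : IsLevelFunction f V) (he : e ∈ edges V)
    (hB : IsIsolatingBox f V y C δ) {w : Y} (hwe : w ∈ e) (hwy : w ≠ y)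
    (hw : w ∈ C ∩ f ⁻¹' Ioo (f y - δ) (f y + δ)) :
    ∃ z ∈ e, z ∈ C ∩ f ⁻¹' {f y - δ / 2} ∪ C ∩ f ⁻¹' {f y + δ / 2} := by
  obtain ⟨hwC, hw₁, hw₂⟩ := hw
  have hfw : f w ≠ f y := fun hfw => hwy (hB.inter_level_subset ⟨hwC, hfw⟩)
  rcases hfw.lt_or_gt with hlt | hlt
  · obtain ⟨z, hz, hfz⟩ := h.subset_image_edge_inter he hB (J := Ioo (f y - δ) (f y)) isOpen_Ioo
      ordConnected_Ioo (Ioo_subset_Ioo_right (by linarith)) (by simp) ⟨w, ⟨hwe, hwC⟩, hw₁, hlt⟩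
      (show f y - δ / 2 ∈ _ by constructor <;> linarith [hB.pos])
    exact ⟨z, hz.1, Or.inl ⟨hz.2, hfz⟩⟩
  · obtain ⟨z, hz, hfz⟩ := h.subset_image_edge_inter he hB (J := Ioo (f y) (f y + δ)) isOpen_Ioo
      ordConnected_Ioo (Ioo_subset_Ioo_left (by linarith)) (by simp) ⟨w, ⟨hwe, hwC⟩, hlt, hw₂⟩
      (show f y + δ / 2 ∈ _ by constructor <;> linarith [hB.pos])
    exact ⟨z, hz.1, Or.inr ⟨hz.2, hfz⟩⟩

theorem exists_finite_edges (h : IsLevelFunction f V) (y : Y) :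
    ∃ F ⊆ edges V, F.Finite ∧ ∀ᶠ w in 𝓝[≠] y, w ∈ ⋃₀ F := by
  obtain ⟨C, -, δ, hB⟩ := h.exists_box y univ univ_mem
  have hV : ∀ {s}, s ≠ f y → Disjoint (C ∩ f ⁻¹' {s}) V := fun {s} hs =>
    disjoint_left.2 fun z hz hzV => hs <| by
      rw [← hB.inter_vertices_subset ⟨hz.1, hzV⟩]
      exact hz.2.symm
  have hneg : f y - δ / 2 ≠ f y := by linarith [hB.pos]
  have hpos : f y + δ / 2 ≠ f y := by linarith [hB.pos]
  set D := C ∩ f ⁻¹' {f y - δ / 2} ∪ C ∩ f ⁻¹' {f y + δ / 2}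
  have hD : D.Finite :=
    (h.finite_inter_level hB.isCompact (hV hneg)).union
      (h.finite_inter_level hB.isCompact (hV hpos))
  have hDV : ∀ z ∈ D, z ∉ V := fun z hz =>
    hz.elim (fun hz => disjoint_left.1 (hV hneg) hz) fun hz => disjoint_left.1 (hV hpos) hz
  refine ⟨connectedComponentIn Vᶜ '' D, ?_, hD.image _, ?_⟩
  · rintro _ ⟨z, hz, rfl⟩
    exact connectedComponentIn_mem_edges (hDV z hz)
  rw [eventually_nhdsWithin_iff]
  filter_upwards [hB.mem_nhds] with w hw hwy
  have hwV : w ∈ Vᶜ := fun hwV => hwy (hB.inter_vertices_subset ⟨hw.1, hwV⟩)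
  obtain ⟨z, hze, hzD⟩ := h.exists_mem_edge_half_level (connectedComponentIn_mem_edges hwV) hB
    (mem_connectedComponentIn hwV) hwy hw
  refine ⟨_, mem_image_of_mem _ hzD, ?_⟩
  rw [← connectedComponentIn_eq hze]
  exact mem_connectedComponentIn hwV

theorem isClosed_of_inter_closure_edge (h : IsLevelFunction f V) (A : Set Y)
    (hA : ∀ e ∈ edges V, IsClosed (A ∩ closure e)) : IsClosed A := by
  rw [← isOpen_compl_iff, isOpen_iff_mem_nhds]
  intro y hy
  obtain ⟨F, hFV, hF, hyF⟩ := h.exists_finite_edges y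
  have hclosed : IsClosed (⋃ e ∈ F, A ∩ closure e) := hF.isClosed_biUnion fun e he => hA e (hFV he)
  have hyA : y ∉ ⋃ e ∈ F, A ∩ closure e := by
    simp only [mem_iUnion]
    exact fun ⟨_, _, hyA, _⟩ => hy hyA
  filter_upwards [eventually_nhdsWithin_iff.1 hyF, hclosed.isOpen_compl.mem_nhds hyA] with w hwF hw
  intro hwA
  obtain ⟨e, he, hwe⟩ := hwF fun hwy => hy (hwy ▸ hwA)
  exact hw (mem_biUnion he ⟨hwA, subset_closure hwe⟩)

variable [T2Space Y]

theorem injOn_edge (h : IsLevelFunction f V) (he : e ∈ edges V) : InjOn f e := by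
  have := Subtype.preconnectedSpace (isConnected_edge he).isPreconnected
  exact injOn_iff_injective.2
    (injective_of_isLocalHomeomorph (h.isLocalHomeomorph_domRestrict_edge he))

theorem isPreconnected_edge_inter (h : IsLevelFunction f V) (he : e ∈ edges V) {J : Set ℝ}
    (hJ : J.OrdConnected) : IsPreconnected (e ∩ f ⁻¹' J) := by
  have hpre : IsPreconnected (e.domRestrict f ⁻¹' (f '' e ∩ J)) := by
    refine IsPreconnected.preimage_of_isOpenMap
      ((h.ordConnected_image_edge he).inter hJ).isPreconnected
      (injOn_iff_injective.1 (h.injOn_edge he))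
      (h.isLocalHomeomorph_domRestrict_edge he).isOpenMap ?_
    rw [range_domRestrict]
    exact inter_subset_left
  convert hpre.image Subtype.val continuous_subtype_val.continuousOn using 1
  ext y
  constructor
  · rintro ⟨hy, hyJ⟩
    exact ⟨⟨y, hy⟩, ⟨⟨y, hy, rfl⟩, hyJ⟩, rfl⟩
  · rintro ⟨⟨z, hz⟩, hzJ, rfl⟩
    exact ⟨hz, hzJ.2⟩

/-- The part of `e` at levels close to `f v` is connected, so it cannot leave an isolating box of
`v` without crossing a level that is far from `f v`. -/
theorem exists_forall_mem_of_mem_closure_edge (h : IsLevelFunction f V) (he : e ∈ edges V) {v : Y}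
    (hv : v ∈ closure e) {O : Set Y} (hO : O ∈ 𝓝 v) :
    ∃ δ > 0, ∀ w ∈ closure e, f w ∈ Ioo (f v - δ) (f v + δ) → w ∈ O := by
  obtain ⟨C, hCO, δ, hB⟩ := h.exists_box v O hO
  have hC := hB.isCompact.isClosed
  have hsub : e ∩ f ⁻¹' Ioo (f v - δ) (f v + δ) ⊆ C ∩ f ⁻¹' Ioo (f v - δ) (f v + δ) := by
    refine (h.isPreconnected_edge_inter he ordConnected_Ioo).subset_of_closure_inter_subset
      hB.isOpen_inter ?_ ?_
    · obtain ⟨z, hz, hze⟩ := mem_closure_iff_nhds.1 hv _ hB.mem_nhds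
      exact ⟨z, ⟨hze, hz.2⟩, hz⟩
    · rintro z ⟨hz, hz'⟩
      exact ⟨hC.closure_subset_iff.2 inter_subset_left hz, hz'.2⟩
  refine ⟨δ, hB.pos, fun w hw hwv => hCO ?_⟩
  have hwcl : w ∈ closure (f ⁻¹' Ioo (f v - δ) (f v + δ) ∩ e) :=
    (isOpen_Ioo.preimage h.continuous).inter_closure ⟨hwv, hw⟩
  rw [inter_comm] at hwcl
  exact hC.closure_subset_iff.2 (hsub.trans inter_subset_left) hwcl

theorem injOn_closure_edge (h : IsLevelFunction f V) (he : e ∈ edges V) :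
    InjOn f (closure e) := by
  intro v hv w hw hvw
  by_contra hne
  obtain ⟨δ, hδ, hmem⟩ := h.exists_forall_mem_of_mem_closure_edge he hv (isOpen_ne.mem_nhds hne)
  exact hmem w hw (by simp [← hvw, hδ]) rfl

theorem isEmbedding_domRestrict_closure_edge (h : IsLevelFunction f V) (he : e ∈ edges V) :
    IsEmbedding ((closure e).domRestrict f) := by
  refine ⟨isInducing_iff_nhds.2 fun ⟨v, hv⟩ => ?_, injOn_iff_injective.1 (h.injOn_closure_edge he)⟩
  refine le_antisymm
    (h.continuous.comp continuous_subtype_val).continuousAt.tendsto.le_comap fun O hO => ?_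
  obtain ⟨O', hO', hO'O⟩ := mem_nhds_subtype _ _ _ |>.1 hO
  obtain ⟨δ, hδ, hmem⟩ := h.exists_forall_mem_of_mem_closure_edge he hv hO'
  exact ⟨Ioo (f v - δ) (f v + δ),
    Ioo_mem_nhds (sub_lt_self (f v) hδ) (lt_add_of_pos_right (f v) hδ),
    fun w hw => hO'O (hmem w w.2 hw)⟩

theorem nonempty_homeomorph_image_closure_edge (h : IsLevelFunction f V) (he : e ∈ edges V) :
    Nonempty (closure e ≃ₜ f '' closure e) :=
  ⟨(h.isEmbedding_domRestrict_closure_edge he).toHomeomorph.trans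
    (Homeomorph.setCongr (range_domRestrict _ _))⟩

theorem image_closure_edge_ne_image_edge [ConnectedSpace Y] (h : IsLevelFunction f V)
    (hV : V.Nonempty) (he : e ∈ edges V) : f '' closure e ≠ f '' e := by
  intro heq
  have hcl : closure e ⊆ e :=
    ((h.injOn_closure_edge he).image_subset_image_iff Subset.rfl subset_closure).1 heq.subset
  have hclopen : IsClopen e := ⟨isClosed_of_closure_subset hcl, h.isOpen_edge he⟩
  obtain ⟨v, hv⟩ := hV
  have hve : v ∈ e := hclopen.eq_univ (isConnected_edge he).nonempty ▸ mem_univ v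
  exact edge_subset_compl he hve hv

section Bounded

variable (hb : Bornology.IsBounded (range f))
include hb

theorem nonempty_homeomorph_edge (h : IsLevelFunction f V) (he : e ∈ edges V) :
    Nonempty (e ≃ₜ ℝ) := by
  obtain ⟨a, b, hab, himg⟩ := h.exists_image_edge_eq_Ioo hb he
  have hemb : IsEmbedding (e.domRestrict f) :=
    (h.isEmbedding_domRestrict_closure_edge he).comp (IsEmbedding.inclusion subset_closure)
  have hr : range (e.domRestrict f) = Ioo a b := by rw [range_domRestrict, himg]
  obtain ⟨ψ⟩ := nonempty_homeomorph_Ioo hab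
  exact ⟨hemb.toHomeomorph.trans ((Homeomorph.setCongr hr).trans ψ)⟩

theorem nonempty_homeomorph_closure_edge [ConnectedSpace Y] (h : IsLevelFunction f V)
    (hV : V.Nonempty) (he : e ∈ edges V) :
    Nonempty (closure e ≃ₜ Icc (-1 : ℝ) 1) ∨ Nonempty (closure e ≃ₜ Ici (0 : ℝ)) := by
  obtain ⟨a, b, hab, himg⟩ := h.exists_image_edge_eq_Ioo hb he
  obtain ⟨φ⟩ := h.nonempty_homeomorph_image_closure_edge he
  have hsup : Ioo a b ⊆ f '' closure e := himg ▸ image_mono subset_closure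
  have hsub : f '' closure e ⊆ Icc a b := by
    rw [← closure_Ioo hab.ne, ← himg]
    exact image_closure_subset_closure_image h.continuous
  have trans : ∀ {s t : Set ℝ}, f '' closure e = s → Nonempty (s ≃ₜ t) →
      Nonempty (closure e ≃ₜ t) := fun heq ⟨ψ⟩ => ⟨φ.trans ((Homeomorph.setCongr heq).trans ψ)⟩
  obtain heq | heq | heq | heq := mem_Icc_Ico_Ioc_Ioo_of_subset_of_subset hsup hsub
  · exact Or.inl (trans heq (nonempty_homeomorph_Icc hab))
  · exact Or.inr (trans heq (nonempty_homeomorph_Ico hab))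
  · exact Or.inr (trans heq (nonempty_homeomorph_Ioc hab))
  · exact absurd (heq.trans himg.symm) (h.image_closure_edge_ne_image_edge hV he)

theorem exists_end_of_not_isCompact (h : IsLevelFunction f V) (he : e ∈ edges V)
    (hc : ¬ IsCompact (closure e)) : ∃ β, β ∉ f '' closure e ∧ β ∈ closure (f '' e) := by
  by_contra! hcon
  have hcl : IsClosed (f '' closure e) := isClosed_of_closure_subset fun β hβ => by
    by_contra hβ'
    exact hcon β hβ' (closure_minimal (image_closure_subset_closure_image h.continuous)
      isClosed_closure hβ)
  have hcpt : IsCompact (f '' closure e) :=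
    Metric.isCompact_of_isClosed_isBounded hcl (hb.subset (image_subset_range _ _))
  obtain ⟨φ⟩ := h.nonempty_homeomorph_image_closure_edge he
  rw [isCompact_iff_compactSpace] at hcpt
  exact hc (isCompact_iff_compactSpace.2 φ.symm.compactSpace)

end Bounded

theorem isGraphWithEnds [ConnectedSpace Y] [Nontrivial Y] (h : IsLevelFunction f V)
    (hb : Bornology.IsBounded (range f)) (hV : V.Nonempty) : IsGraphWithEnds Y V where
  connected := inferInstance
  hausdorff := inferInstance
  isClosed_vertices := h.isClosed_vertices
  discrete_vertices := h.discrete_vertices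
  edges_nonempty := h.edges_nonempty
  isOpen_edge _ he := h.isOpen_edge he
  edge_homeo _ he := h.nonempty_homeomorph_edge hb he
  weak_topology := h.isClosed_of_inter_closure_edge
  closure_edge _ he := h.nonempty_homeomorph_closure_edge hb hV he

end IsLevelFunction

end LevelFunction

section RealFunctions

theorem deriv_nonneg_of_frequently_neg {φ : ℝ → ℝ} {a d : ℝ} (hd : HasDerivAt φ d a)
    (ha : φ a = 0) (hneg : ∃ᶠ x in 𝓝[<] a, φ x < 0) : 0 ≤ d := by
  refine ge_of_tendsto_of_frequently (hasDerivAt_iff_tendsto_slope_left_right.1 hd).1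
    ((hneg.and_eventually self_mem_nhdsWithin).mono fun x ⟨hx, hxa⟩ => ?_)
  rw [slope_def_field, ha, sub_zero]
  exact div_nonneg_of_nonpos hx.le (sub_nonpos.2 (le_of_lt hxa))

theorem exists_left_end {φ : ℝ → ℝ} (hφ : Continuous φ) {a' x₀ : ℝ} (ha' : φ a' < 0)
    (hlt : a' < x₀) (hx₀ : 0 ≤ φ x₀) :
    ∃ a ∈ Ioc a' x₀, φ a = 0 ∧ (∀ x ∈ Icc a x₀, 0 ≤ φ x) ∧ ∀ d, HasDerivAt φ d a → 0 ≤ d := by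
  have ha'S : a' ∈ {x ∈ Icc a' x₀ | φ x < 0} := ⟨⟨le_rfl, hlt.le⟩, ha'⟩
  obtain ⟨a, hlub⟩ := Real.exists_isLUB ⟨a', ha'S⟩ ⟨x₀, fun x hx => hx.1.2⟩
  have ha'a : a' ≤ a := hlub.1 ha'S
  have hax₀ : a ≤ x₀ := hlub.2 fun x hx => hx.1.2
  have hpos : Icc a x₀ ⊆ {x | 0 ≤ φ x} := by
    rcases hax₀.eq_or_lt with rfl | hax₀'
    · simpa using hx₀
    rw [← closure_Ioc hax₀'.ne]
    refine closure_minimal (fun x hx => show 0 ≤ φ x from le_of_not_gt fun hneg : φ x < 0 => ?_)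
      (isClosed_le continuous_const hφ)
    exact hx.1.not_ge (hlub.1 ⟨⟨ha'a.trans hx.1.le, hx.2⟩, hneg⟩)
  have hposa : 0 ≤ φ a := hpos (left_mem_Icc.2 hax₀)
  have hfreq : ∃ᶠ x in 𝓝[≤] a, φ x < 0 := (hlub.frequently_mem ⟨a', ha'S⟩).mono fun x hx => hx.2
  have ha : φ a = 0 := by
    refine le_antisymm ?_ hposa
    exact le_of_tendsto_of_frequently (hφ.continuousWithinAt (s := Iic a))
      (hfreq.mono fun x hx => hx.le)
  refine ⟨a, ⟨ha'a.lt_of_ne ?_, hax₀⟩, ha, hpos, fun d hd => ?_⟩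
  · rintro rfl
    exact hposa.not_gt ha'
  · refine deriv_nonneg_of_frequently_neg hd ha ?_
    rw [frequently_nhdsWithin_iff] at hfreq ⊢
    exact hfreq.mono fun x ⟨hx, hxa⟩ =>
      ⟨hx, lt_of_le_of_ne hxa fun heq : x = a => hposa.not_gt (heq ▸ hx)⟩

theorem exists_right_end {φ : ℝ → ℝ} (hφ : Continuous φ) {b' x₀ : ℝ} (hb' : φ b' < 0)
    (hlt : x₀ < b') (hx₀ : 0 ≤ φ x₀) :
    ∃ b ∈ Ico x₀ b', φ b = 0 ∧ (∀ x ∈ Icc x₀ b, 0 ≤ φ x) ∧ ∀ d, HasDerivAt φ d b → d ≤ 0 := by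
  obtain ⟨a, ha, ha0, hpos, hderiv⟩ := exists_left_end (φ := fun x => φ (-x)) (a' := -b')
    (x₀ := -x₀) (by fun_prop) (by simpa using hb') (neg_lt_neg hlt) (by simpa using hx₀)
  refine ⟨-a, ⟨le_neg.1 ha.2, neg_lt.1 ha.1⟩, ha0, fun x hx => ?_, fun d hd => ?_⟩
  · simpa using hpos (-x) ⟨le_neg.1 hx.2, neg_le_neg hx.1⟩
  · have hneg := HasDerivAt.scomp (h := fun x : ℝ => -x) a hd (hasDerivAt_neg a)
    simpa using hderiv _ hneg

theorem exists_regular_component {φ ψ : ℝ → ℝ} (hd : ∀ x, HasDerivAt φ (ψ x) x) {a' x₀ b' : ℝ}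
    (ha' : φ a' < 0) (hb' : φ b' < 0) (hax : a' < x₀) (hxb : x₀ < b') (hx₀ : 0 ≤ φ x₀)
    (hreg : ∀ x, (∀ w ∈ uIcc x₀ x, 0 ≤ φ w) → φ x = 0 → ψ x ≠ 0) :
    ∃ a b, x₀ ∈ Icc a b ∧ φ a = 0 ∧ 0 < ψ a ∧ φ b = 0 ∧ ψ b < 0 ∧ ∀ x ∈ Ioo a b, 0 < φ x := by
  have hφ : Continuous φ := continuous_iff_continuousAt.2 fun x => (hd x).continuousAt
  obtain ⟨a, ha, ha0, hapos, haderiv⟩ := exists_left_end hφ ha' hax hx₀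
  obtain ⟨b, hb, hb0, hbpos, hbderiv⟩ := exists_right_end hφ hb' hxb hx₀
  have hpos : ∀ x ∈ Icc a b, 0 ≤ φ x := fun x hx =>
    (le_total x x₀).elim (fun h => hapos x ⟨hx.1, h⟩) fun h => hbpos x ⟨h, hx.2⟩
  have hx₀ab : x₀ ∈ Icc a b := ⟨ha.2, hb.1⟩
  have hreg' : ∀ x ∈ Icc a b, φ x = 0 → ψ x ≠ 0 := fun x hx =>
    hreg x fun w hw => hpos w (ordConnected_Icc.uIcc_subset hx₀ab hx hw)
  have hab : a ≤ b := hx₀ab.1.trans hx₀ab.2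
  refine ⟨a, b, hx₀ab, ha0, ?_, hb0, ?_, fun x hx => ?_⟩
  · exact (haderiv _ (hd a)).lt_of_ne' (hreg' a (left_mem_Icc.2 hab) ha0)
  · exact (hbderiv _ (hd b)).lt_of_ne (hreg' b (right_mem_Icc.2 hab) hb0)
  · have hx' := Ioo_subset_Icc_self hx
    refine (hpos x hx').lt_of_ne' fun hzero => hreg' x hx' hzero ?_
    refine IsLocalMin.hasDerivAt_eq_zero (f := φ) ?_ (hd x)
    filter_upwards [Icc_mem_nhds hx.1 hx.2] with w hw
    rw [hzero]
    exact hpos w hw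

variable {φ ψ : ℝ → ℝ → ℝ} {t : ℝ}

theorem eventually_strictMonoOn_Icc (hd : ∀ s x, HasDerivAt (φ s) (ψ s x) x)
    (hψ : Continuous fun p : ℝ × ℝ => ψ p.1 p.2) {a : ℝ} (hpos : 0 < ψ t a) :
    ∀ᶠ r in 𝓝 (0 : ℝ), ∀ᶠ s in 𝓝 t, StrictMonoOn (φ s) (Icc (a - r) (a + r)) := by
  have hev : ∀ᶠ p : ℝ × ℝ in 𝓝 t ×ˢ 𝓝 a, 0 < ψ p.1 p.2 := by
    rw [← nhds_prod_eq]
    exact hψ.continuousAt.eventually (lt_mem_nhds hpos)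
  obtain ⟨S, hS, A, hA, hSA⟩ := eventually_prod_iff.1 hev
  obtain ⟨ε, hε, hball⟩ := Metric.eventually_nhds_iff.1 hA
  filter_upwards [gt_mem_nhds hε] with r hr
  filter_upwards [hS] with s hs
  refine strictMonoOn_of_hasDerivWithinAt_pos (f' := ψ s) (convex_Icc _ _)
    (fun x _ => (hd s x).continuousAt.continuousWithinAt)
    (fun x _ => (hd s x).hasDerivWithinAt) fun x hx => hSA hs (hball ?_)
  rw [interior_Icc] at hx
  rw [Real.dist_eq, abs_lt]
  constructor <;> linarith [hx.1, hx.2]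

theorem ordConnected_nonneg_of_strictMonoOn {φ : ℝ → ℝ} {a b r : ℝ}
    (hmono : StrictMonoOn φ (Icc (a - r) (a + r)))
    (hanti : StrictMonoOn (fun x => -φ x) (Icc (b - r) (b + r)))
    (hpos : ∀ x ∈ Icc (a + r) (b - r), 0 ≤ φ x) :
    (Icc (a - r) (b + r) ∩ {x | 0 ≤ φ x}).OrdConnected := by
  refine ⟨fun x ⟨hx, hx0⟩ y ⟨hy, hy0⟩ w hw => ⟨⟨hx.1.trans hw.1, hw.2.trans hy.2⟩, ?_⟩⟩
  rcases le_total w (a + r) with hwa | hwa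
  · exact le_trans hx0 (hmono.monotoneOn ⟨hx.1, hw.1.trans hwa⟩ ⟨hx.1.trans hw.1, hwa⟩ hw.1)
  rcases le_total w (b - r) with hwb | hwb
  · exact hpos w ⟨hwa, hwb⟩
  · exact le_trans hy0 (neg_le_neg_iff.1
      (hanti.monotoneOn ⟨hwb, hw.2.trans hy.2⟩ ⟨hwb.trans hw.2, hy.2⟩ hw.2))

theorem exists_box_of_regular_component (hφ : Continuous fun p : ℝ × ℝ => φ p.1 p.2)
    (hd : ∀ s x, HasDerivAt (φ s) (ψ s x) x) (hψ : Continuous fun p : ℝ × ℝ => ψ p.1 p.2)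
    {a b : ℝ} (hab : a < b) (ha : φ t a = 0) (hda : 0 < ψ t a) (hb : φ t b = 0) (hdb : ψ t b < 0)
    (hpos : ∀ x ∈ Ioo a b, 0 < φ t x) :
    ∃ r > 0, a + r < b ∧ ∀ᶠ s in 𝓝 t, φ s (a - r) < 0 ∧ φ s (b + r) < 0 ∧ 0 ≤ φ s (a + r) ∧
      (Icc (a - r) (b + r) ∩ {x | 0 ≤ φ s x}).OrdConnected := by
  obtain ⟨r, ⟨hmono, hanti, hrab⟩, hr⟩ := ((((eventually_strictMonoOn_Icc hd hψ hda).and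
    ((eventually_strictMonoOn_Icc (fun s x => (hd s x).neg) hψ.neg (neg_pos.2 hdb)).and
      (gt_mem_nhds (half_pos (sub_pos.2 hab))))).filter_mono nhdsWithin_le_nhds).and
      self_mem_nhdsWithin : ∀ᶠ r in 𝓝[>] (0 : ℝ), _).exists
  replace hr : 0 < r := hr
  have hleft : φ t (a - r) < 0 := ha ▸ hmono.self_of_nhds
    ⟨le_rfl, by linarith⟩ ⟨by linarith, by linarith⟩ (by linarith)
  have hright : φ t (b + r) < 0 := hb ▸ neg_lt_neg_iff.1 (hanti.self_of_nhds
    ⟨by linarith, by linarith⟩ ⟨by linarith, le_rfl⟩ (by linarith))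
  have hmid : ∀ᶠ s in 𝓝 t, ∀ x ∈ Icc (a + r) (b - r), 0 < φ s x :=
    isCompact_Icc.eventually_forall_of_forall_eventually fun x hx =>
      (hφ.continuousAt (x := (t, x))).eventually
        (lt_mem_nhds (hpos x ⟨by linarith [hx.1], by linarith [hx.2]⟩))
  have hcont : ∀ x, ContinuousAt (fun s => φ s x) t := fun x =>
    (hφ.comp (by fun_prop : Continuous fun s => (s, x))).continuousAt
  refine ⟨r, hr, by linarith, ?_⟩
  filter_upwards [hmono, hanti, hmid, (hcont _).eventually (gt_mem_nhds hleft),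
    (hcont _).eventually (gt_mem_nhds hright)] with s hmono hanti hmid hleft hright
  exact ⟨hleft, hright, (hmid _ ⟨le_rfl, by linarith⟩).le,
    ordConnected_nonneg_of_strictMonoOn hmono hanti fun x hx => (hmid x hx).le⟩

end RealFunctions

section StripQuotients

variable {c₁ c₂ : ℝ → ℝ}

/-- The slice at level `s` of the closed region between the graphs of `c₁` and `c₂`: the second
coordinates of its points with first coordinate `s`. -/
def slice (c₁ c₂ : ℝ → ℝ) (s : ℝ) : Set ℝ :=
  {x | c₁ x ≤ s ∧ s ≤ c₂ x}

/-- The closed region between the graphs of `c₁` and `c₂`, with the level as first coordinate. -/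
def strip (c₁ c₂ : ℝ → ℝ) : Set (ℝ × ℝ) :=
  {p | p.2 ∈ slice c₁ c₂ p.1}

/-- The function `(s - c₁) (c₂ - s)`, whose non-negativity defines the strip. -/
def stripFn (c₁ c₂ : ℝ → ℝ) (s x : ℝ) : ℝ :=
  (s - c₁ x) * (c₂ x - s)

/-- The derivative of `stripFn` in its second variable. -/
noncomputable def stripDeriv (c₁ c₂ : ℝ → ℝ) (s x : ℝ) : ℝ :=
  -deriv c₁ x * (c₂ x - s) + (s - c₁ x) * deriv c₂ x

/-- The line at level `s` is tangent to one of the boundary curves of the strip over `x`. -/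
def IsTangency (c₁ c₂ : ℝ → ℝ) (s x : ℝ) : Prop :=
  (c₁ x = s ∧ deriv c₁ x = 0) ∨ (c₂ x = s ∧ deriv c₂ x = 0)

/-- The points of the strip at which its level is tangent to one of its boundary curves. -/
def tangencies (c₁ c₂ : ℝ → ℝ) : Set (strip c₁ c₂) :=
  {p | IsTangency c₁ c₂ p.1.1 p.1.2}

theorem stripFn_nonneg_iff (hlt : ∀ x, c₁ x < c₂ x) {s x : ℝ} :
    0 ≤ stripFn c₁ c₂ s x ↔ x ∈ slice c₁ c₂ s := by
  have := hlt x
  refine ⟨fun h => ?_, fun h => mul_nonneg (sub_nonneg.2 h.1) (sub_nonneg.2 h.2)⟩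
  rcases mul_nonneg_iff.1 h with h | h
  · exact ⟨sub_nonneg.1 h.1, sub_nonneg.1 h.2⟩
  · linarith [h.1, h.2]

theorem stripFn_neg_iff (hlt : ∀ x, c₁ x < c₂ x) {s x : ℝ} :
    stripFn c₁ c₂ s x < 0 ↔ x ∉ slice c₁ c₂ s := by
  rw [← stripFn_nonneg_iff hlt, not_le]

theorem continuous_stripFn (h₁ : Continuous c₁) (h₂ : Continuous c₂) :
    Continuous fun p : ℝ × ℝ => stripFn c₁ c₂ p.1 p.2 := by
  unfold stripFn
  fun_prop

theorem hasDerivAt_stripFn (h₁ : Differentiable ℝ c₁) (h₂ : Differentiable ℝ c₂) (s x : ℝ) :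
    HasDerivAt (stripFn c₁ c₂ s) (stripDeriv c₁ c₂ s x) x :=
  ((h₁ x).hasDerivAt.const_sub s).mul ((h₂ x).hasDerivAt.sub_const s)

theorem continuous_stripDeriv (h₁ : ContDiff ℝ 1 c₁) (h₂ : ContDiff ℝ 1 c₂) :
    Continuous fun p : ℝ × ℝ => stripDeriv c₁ c₂ p.1 p.2 := by
  have hd₁ := h₁.continuous_deriv_one
  have hd₂ := h₂.continuous_deriv_one
  exact ((hd₁.comp continuous_snd).neg.mul ((h₂.continuous.comp continuous_snd).sub
    continuous_fst)).add ((continuous_fst.sub (h₁.continuous.comp continuous_snd)).mul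
    (hd₂.comp continuous_snd))

theorem isTangency_iff (hlt : ∀ x, c₁ x < c₂ x) {s x : ℝ} :
    IsTangency c₁ c₂ s x ↔ stripFn c₁ c₂ s x = 0 ∧ stripDeriv c₁ c₂ s x = 0 := by
  have hne : c₂ x - c₁ x ≠ 0 := sub_ne_zero.2 (hlt x).ne'
  constructor
  · rintro (⟨rfl, h⟩ | ⟨rfl, h⟩) <;> simp [stripFn, stripDeriv, h]
  · rintro ⟨h0, hd⟩
    rcases mul_eq_zero.1 h0 with h | h
    · obtain rfl := sub_eq_zero.1 h
      left
      simpa [stripDeriv, hne] using hd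
    · obtain rfl := sub_eq_zero.1 h
      right
      simpa [stripDeriv, hne] using hd

theorem IsTangency.mem_slice (hlt : ∀ x, c₁ x < c₂ x) {s x : ℝ} (h : IsTangency c₁ c₂ s x) :
    x ∈ slice c₁ c₂ s := by
  rcases h with ⟨rfl, -⟩ | ⟨rfl, -⟩
  · exact ⟨le_rfl, (hlt x).le⟩
  · exact ⟨(hlt x).le, le_rfl⟩

theorem isClosed_strip (h₁ : Continuous c₁) (h₂ : Continuous c₂) : IsClosed (strip c₁ c₂) :=
  (isClosed_le (h₁.comp continuous_snd) continuous_fst).inter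
    (isClosed_le continuous_fst (h₂.comp continuous_snd))

theorem isClosed_slice (h₁ : Continuous c₁) (h₂ : Continuous c₂) (s : ℝ) :
    IsClosed (slice c₁ c₂ s) :=
  (isClosed_strip h₁ h₂).preimage (by fun_prop : Continuous fun x : ℝ => (s, x))

theorem isOpen_setOf_notMem_slice (x : ℝ) : IsOpen {s | x ∉ slice c₁ c₂ s} :=
  (isClosed_Icc : IsClosed (Icc (c₁ x) (c₂ x))).isOpen_compl

theorem eventually_notMem_slice {t x : ℝ} (hx : x ∉ slice c₁ c₂ t) :
    ∀ᶠ s in 𝓝 t, x ∉ slice c₁ c₂ s :=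
  (isOpen_setOf_notMem_slice x).mem_nhds hx

theorem isCompact_box (h₁ : Continuous c₁) (h₂ : Continuous c₂) (a b u v : ℝ) :
    IsCompact {p : strip c₁ c₂ | p.1.2 ∈ Icc a b ∧ p.1.1 ∈ Icc u v} := by
  convert (isClosed_strip h₁ h₂).isClosedEmbedding_subtypeVal.isCompact_preimage
    ((isCompact_Icc (a := u) (b := v)).prod (isCompact_Icc (a := a) (b := b))) using 1
  ext p
  exact and_comm

/-- The retraction of the plane onto the strip that moves each point along its own line of constant
second coordinate. -/
def stripRetraction (hle : ∀ x, c₁ x ≤ c₂ x) (p : ℝ × ℝ) : strip c₁ c₂ :=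
  ⟨(max (c₁ p.2) (min p.1 (c₂ p.2)), p.2), le_max_left _ _, max_le (hle _) (min_le_right _ _)⟩

theorem continuous_stripRetraction (h₁ : Continuous c₁) (h₂ : Continuous c₂)
    (hle : ∀ x, c₁ x ≤ c₂ x) : Continuous (stripRetraction hle) := by
  unfold stripRetraction
  fun_prop

theorem stripRetraction_of_mem (hle : ∀ x, c₁ x ≤ c₂ x) {p : ℝ × ℝ} (hp : p ∈ strip c₁ c₂) :
    stripRetraction hle p = ⟨p, hp⟩ := by
  have h₁ : c₁ p.2 ≤ p.1 := hp.1
  have h₂ : p.1 ≤ c₂ p.2 := hp.2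
  simp [stripRetraction, h₁, h₂]

theorem isPreconnected_strip_over (h₁ : Continuous c₁) (h₂ : Continuous c₂)
    (hle : ∀ x, c₁ x ≤ c₂ x) {Q : Set ℝ} (hQ : IsPreconnected Q) :
    IsPreconnected {p : strip c₁ c₂ | p.1.2 ∈ Q} := by
  convert (isPreconnected_univ.prod hQ).image _ (continuous_stripRetraction h₁ h₂ hle).continuousOn
  ext p
  constructor
  · exact fun hp => ⟨p.1, ⟨mem_univ _, hp⟩, stripRetraction_of_mem hle p.2⟩
  · rintro ⟨q, hq, rfl⟩
    exact hq.2

theorem mem_of_uIcc_subset {S Q : Set ℝ} {x y : ℝ} (hQ : Disjoint (frontier Q) S)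
    (hxy : uIcc x y ⊆ S) (hx : x ∈ Q) : y ∈ Q := by
  have hcover : uIcc x y ⊆ interior Q ∪ (closure Q)ᶜ := fun w hw => by
    by_contra hwQ
    rw [mem_union, not_or, notMem_compl_iff] at hwQ
    exact disjoint_left.1 hQ hwQ.symm (hxy hw)
  have hx' : x ∈ interior Q :=
    (hcover left_mem_uIcc).resolve_right fun hxQ => hxQ (subset_closure hx)
  exact interior_subset (isPreconnected_uIcc.subset_left_of_subset_union isOpen_interior
    isClosed_closure.isOpen_compl (disjoint_compl_right_iff_subset.2 interior_subset_closure)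
    hcover ⟨x, left_mem_uIcc, hx'⟩ right_mem_uIcc)

/-- The component of the slice at the level `t` through `x₀` is isolated in its slice, by a box
that contains no tangency at any other nearby level. -/
def HasBoxAt (c₁ c₂ : ℝ → ℝ) (t x₀ : ℝ) : Prop :=
  ∃ a b, x₀ ∈ Ioo a b ∧ a ∉ slice c₁ c₂ t ∧ b ∉ slice c₁ c₂ t ∧
    (Icc a b ∩ slice c₁ c₂ t).OrdConnected ∧
    ∀ᶠ s in 𝓝 t, ∀ x ∈ Icc a b, IsTangency c₁ c₂ s x → s = t

/-- Every component of every slice has an isolating box, as it must if the space of these components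
is to be a graph with the components of tangencies as its vertices. -/
def HasBoxes (c₁ c₂ : ℝ → ℝ) : Prop :=
  ∀ t, ∀ x₀ ∈ slice c₁ c₂ t, HasBoxAt c₁ c₂ t x₀

/-- The map `ρ` is a quotient map of the strip onto the space of the components of all slices, and
`f` is the level function of this space. -/
structure IsSliceQuotient {Y : Type*} [TopologicalSpace Y] (ρ : strip c₁ c₂ → Y) (f : Y → ℝ) :
    Prop where
  isQuotientMap : IsQuotientMap ρ
  level : ∀ p, f (ρ p) = p.1.1
  eq_iff : ∀ p q, ρ p = ρ q ↔ p.1.1 = q.1.1 ∧ uIcc p.1.2 q.1.2 ⊆ slice c₁ c₂ p.1.1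

namespace IsSliceQuotient

variable {Y : Type*} [TopologicalSpace Y] {ρ : strip c₁ c₂ → Y} {f : Y → ℝ}

theorem continuous (h : IsSliceQuotient ρ f) : Continuous f := by
  rw [h.isQuotientMap.continuous_iff, show f ∘ ρ = fun p => p.1.1 from funext h.level]
  fun_prop

theorem mem_image_box_iff (h : IsSliceQuotient ρ f) {Q J : Set ℝ}
    (hQJ : ∀ s ∈ J, Disjoint (frontier Q) (slice c₁ c₂ s)) {p : strip c₁ c₂} :
    ρ p ∈ ρ '' {p | p.1.2 ∈ Q ∧ p.1.1 ∈ J} ↔ p.1.2 ∈ Q ∧ p.1.1 ∈ J := by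
  refine ⟨?_, fun hp => mem_image_of_mem ρ hp⟩
  rintro ⟨q, ⟨hqQ, hqJ⟩, hqp⟩
  obtain ⟨hlevel, hseg⟩ := (h.eq_iff q p).1 hqp
  exact ⟨mem_of_uIcc_subset (hQJ _ hqJ) hseg hqQ, hlevel ▸ hqJ⟩

theorem isOpen_image_box (h : IsSliceQuotient ρ f) {Q J : Set ℝ} (hQ : IsOpen Q) (hJ : IsOpen J)
    (hQJ : ∀ s ∈ J, Disjoint (frontier Q) (slice c₁ c₂ s)) :
    IsOpen (ρ '' {p | p.1.2 ∈ Q ∧ p.1.1 ∈ J}) := by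
  rw [← h.isQuotientMap.isOpen_preimage]
  convert (hQ.preimage (by fun_prop : Continuous fun p : strip c₁ c₂ => p.1.2)).inter
    (hJ.preimage (by fun_prop : Continuous fun p : strip c₁ c₂ => p.1.1)) using 1
  ext p
  exact h.mem_image_box_iff hQJ

/-- Two components of the same slice are separated by a point `z` outside the slice, hence outside
all slices at nearby levels. -/
theorem t2Space (h : IsSliceQuotient ρ f) : T2Space Y := by
  refine ⟨fun y y' hyy' => ?_⟩
  obtain ⟨p, rfl⟩ := h.isQuotientMap.surjective y
  obtain ⟨q, rfl⟩ := h.isQuotientMap.surjective y'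
  by_cases hlev : p.1.1 = q.1.1
  swap
  · exact separated_by_continuous h.continuous (by rwa [h.level, h.level])
  wlog hpq : p.1.2 ≤ q.1.2 generalizing p q
  · obtain ⟨u, v, hu, hv, hqu, hpv, huv⟩ := this q p hyy'.symm hlev.symm (le_of_not_ge hpq)
    exact ⟨v, u, hv, hu, hpv, hqu, huv.symm⟩
  obtain ⟨z, hz, hzs⟩ : ∃ z ∈ Icc p.1.2 q.1.2, z ∉ slice c₁ c₂ p.1.1 := by
    by_contra! hcon
    exact hyy' ((h.eq_iff p q).2 ⟨hlev, by rwa [uIcc_of_le hpq]⟩)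
  have hpz : p.1.2 < z := hz.1.lt_of_ne (by rintro rfl; exact hzs p.2)
  have hzq : z < q.1.2 := hz.2.lt_of_ne (by rintro rfl; exact hzs (hlev ▸ q.2))
  have hJ : IsOpen {s | z ∉ slice c₁ c₂ s} := isOpen_setOf_notMem_slice z
  have hIio : ∀ s ∈ {s | z ∉ slice c₁ c₂ s}, Disjoint (frontier (Iio z)) (slice c₁ c₂ s) := by simp
  have hIoi : ∀ s ∈ {s | z ∉ slice c₁ c₂ s}, Disjoint (frontier (Ioi z)) (slice c₁ c₂ s) := by simp
  refine ⟨_, _, h.isOpen_image_box isOpen_Iio hJ hIio, h.isOpen_image_box isOpen_Ioi hJ hIoi,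
    ⟨p, ⟨hpz, hzs⟩, rfl⟩, ⟨q, ⟨hzq, hlev ▸ hzs⟩, rfl⟩, disjoint_left.2 ?_⟩
  rintro _ ⟨r, hr, rfl⟩ hr'
  exact lt_asymm (show r.1.2 < z from hr.1) ((h.mem_image_box_iff hIoi).1 hr').1

theorem isIsolatingBox_image_box (h : IsSliceQuotient ρ f) (h₁ : Continuous c₁)
    (h₂ : Continuous c₂) {a b δ : ℝ} {p₀ : strip c₁ c₂} (hδ : 0 < δ) (hp₀ : p₀.1.2 ∈ Icc a b)
    (hord : (Icc a b ∩ slice c₁ c₂ p₀.1.1).OrdConnected)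
    (hends : ∀ s ∈ Icc (p₀.1.1 - δ) (p₀.1.1 + δ), a ∉ slice c₁ c₂ s ∧ b ∉ slice c₁ c₂ s)
    (htan : ∀ s ∈ Icc (p₀.1.1 - δ) (p₀.1.1 + δ), ∀ x ∈ Icc a b,
      IsTangency c₁ c₂ s x → s = p₀.1.1) :
    IsIsolatingBox f (ρ '' tangencies c₁ c₂) (ρ p₀)
      (ρ '' {p | p.1.2 ∈ Icc a b ∧ p.1.1 ∈ Icc (p₀.1.1 - δ) (p₀.1.1 + δ)}) δ := by
  have hab : a ≤ b := hp₀.1.trans hp₀.2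
  have hfr : ∀ s ∈ Icc (p₀.1.1 - δ) (p₀.1.1 + δ),
      Disjoint (frontier (Icc a b)) (slice c₁ c₂ s) := fun s hs => by
    simpa [frontier_Icc hab] using hends s hs
  have hlevel : ∀ p : strip c₁ c₂, p.1.2 ∈ Icc a b → p.1.1 = p₀.1.1 → ρ p = ρ p₀ :=
    fun p hp hpp₀ => (h.eq_iff p p₀).2 ⟨hpp₀, by
      rw [hpp₀]
      exact (hord.uIcc_subset ⟨hp, hpp₀ ▸ p.2⟩ ⟨hp₀, p₀.2⟩).trans inter_subset_right⟩
  refine ⟨hδ, (isCompact_box h₁ h₂ a b _ _).image h.isQuotientMap.continuous,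
    ⟨p₀, ⟨hp₀, by simp [hδ.le]⟩, rfl⟩, ?_, ?_, ?_⟩
  · rintro _ ⟨hp, p, hpt, rfl⟩
    obtain ⟨hpab, hpδ⟩ := (h.mem_image_box_iff hfr).1 hp
    exact hlevel p hpab (htan _ hpδ _ hpab hpt)
  · rintro _ ⟨⟨p, ⟨hp, -⟩, rfl⟩, hpp₀⟩
    exact hlevel p hp (by simpa [h.level] using hpp₀)
  · convert h.isOpen_image_box (Q := Ioo a b) (J := Ioo (p₀.1.1 - δ) (p₀.1.1 + δ)) isOpen_Ioo
      isOpen_Ioo (fun s hs => ?_) using 1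
    · ext y
      rw [h.level]
      constructor
      · rintro ⟨⟨p, ⟨hp, hpδ⟩, rfl⟩, hf⟩
        rw [mem_preimage, h.level] at hf
        have ha : a ≠ p.1.2 := fun hap => (hends _ hpδ).1 (hap ▸ p.2)
        have hb : p.1.2 ≠ b := fun hpb => (hends _ hpδ).2 (hpb ▸ p.2)
        exact ⟨p, ⟨⟨hp.1.lt_of_ne ha, hp.2.lt_of_ne hb⟩, hf⟩, rfl⟩
      · rintro ⟨p, ⟨hp, hpδ⟩, rfl⟩
        refine ⟨⟨p, ⟨Ioo_subset_Icc_self hp, Ioo_subset_Icc_self hpδ⟩, rfl⟩, ?_⟩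
        rwa [mem_preimage, h.level]
    · rw [← interior_Icc]
      exact (hfr s (Ioo_subset_Icc_self hs)).mono_left frontier_interior_subset

/-- Tube lemma: the part at level `t` of the box over `[a, b]` is mapped to a single point. -/
theorem eventually_image_mem (h : IsSliceQuotient ρ f) (h₁ : Continuous c₁) (h₂ : Continuous c₂)
    {a b : ℝ} {p₀ : strip c₁ c₂} (hp₀ : p₀.1.2 ∈ Icc a b)
    (hord : (Icc a b ∩ slice c₁ c₂ p₀.1.1).OrdConnected) {O : Set Y} (hO : O ∈ 𝓝 (ρ p₀)) :
    ∀ᶠ s in 𝓝 p₀.1.1, ∀ x ∈ Icc a b, ∀ hx : (s, x) ∈ strip c₁ c₂, ρ ⟨(s, x), hx⟩ ∈ O := by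
  refine isCompact_Icc.eventually_forall_of_forall_eventually fun x hx => ?_
  by_cases hxs : (p₀.1.1, x) ∈ strip c₁ c₂
  · have hρ : ρ ⟨(p₀.1.1, x), hxs⟩ = ρ p₀ := (h.eq_iff _ _).2
      ⟨rfl, (hord.uIcc_subset ⟨hx, hxs⟩ ⟨hp₀, p₀.2⟩).trans inter_subset_right⟩
    obtain ⟨U, hU, hUO⟩ := (mem_nhds_subtype _ _ _).1
      (h.isQuotientMap.continuous.continuousAt.preimage_mem_nhds (hρ ▸ hO))
    filter_upwards [hU] with q hq hqs
    exact hUO (a := ⟨q, hqs⟩) hq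
  · filter_upwards [(isClosed_strip h₁ h₂).isOpen_compl.mem_nhds hxs] with q hq hqs
    exact absurd hqs hq

theorem exists_isIsolatingBox (h : IsSliceQuotient ρ f) (h₁ : Continuous c₁) (h₂ : Continuous c₂)
    (hbox : HasBoxes c₁ c₂) (y : Y) {O : Set Y} (hO : O ∈ 𝓝 y) :
    ∃ C ⊆ O, ∃ δ, IsIsolatingBox f (ρ '' tangencies c₁ c₂) y C δ := by
  obtain ⟨p₀, rfl⟩ := h.isQuotientMap.surjective y
  obtain ⟨a, b, hab, ha, hb, hord, htan⟩ := hbox _ _ p₀.2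
  have hp₀ := Ioo_subset_Icc_self hab
  obtain ⟨δ, hδ, hball⟩ := Metric.nhds_basis_closedBall.eventually_iff.1
    (((eventually_notMem_slice ha).and (eventually_notMem_slice hb)).and
      (htan.and (h.eventually_image_mem h₁ h₂ hp₀ hord hO)))
  rw [Real.closedBall_eq_Icc] at hball
  refine ⟨_, ?_, δ, h.isIsolatingBox_image_box h₁ h₂ hδ hp₀ hord (fun s hs => (hball hs).1)
    fun s hs => (hball hs).2.1⟩
  rintro _ ⟨p, ⟨hp, hpδ⟩, rfl⟩
  exact (hball hpδ).2.2 _ hp p.2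

theorem exists_regular_box (h : IsSliceQuotient ρ f) (h₁ : ContDiff ℝ 1 c₁) (h₂ : ContDiff ℝ 1 c₂)
    (hlt : ∀ x, c₁ x < c₂ x) (hbox : HasBoxes c₁ c₂) {p₀ : strip c₁ c₂}
    (hp₀ : ρ p₀ ∉ ρ '' tangencies c₁ c₂) :
    ∃ a b x₁, p₀.1.2 ∈ Ioo a b ∧ x₁ ∈ Ioo a b ∧ ∀ᶠ s in 𝓝 p₀.1.1, a ∉ slice c₁ c₂ s ∧
      b ∉ slice c₁ c₂ s ∧ x₁ ∈ slice c₁ c₂ s ∧ (Icc a b ∩ slice c₁ c₂ s).OrdConnected := by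
  obtain ⟨a', b', hx₀, ha', hb', -, -⟩ := hbox _ _ p₀.2
  have hd := hasDerivAt_stripFn (h₁.differentiable_one) (h₂.differentiable_one)
  obtain ⟨a, b, hab, ha, hda, hb, hdb, hpos⟩ := exists_regular_component (hd p₀.1.1)
    ((stripFn_neg_iff hlt).2 ha') ((stripFn_neg_iff hlt).2 hb') hx₀.1 hx₀.2
    ((stripFn_nonneg_iff hlt).2 p₀.2) fun x hx h0 hd0 => by
      have htan : IsTangency c₁ c₂ p₀.1.1 x := (isTangency_iff hlt).2 ⟨h0, hd0⟩
      exact hp₀ ⟨⟨(p₀.1.1, x), htan.mem_slice hlt⟩, htan, ((h.eq_iff p₀ ⟨(_, x), _⟩).2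
        ⟨rfl, fun w hw => (stripFn_nonneg_iff hlt).1 (hx w hw)⟩).symm⟩
  have hab' : a < b := (hab.1.trans hab.2).lt_of_ne (by rintro rfl; exact lt_asymm hda hdb)
  obtain ⟨r, hr, hrab, hev⟩ := exists_box_of_regular_component
    (continuous_stripFn h₁.continuous h₂.continuous) hd (continuous_stripDeriv h₁ h₂) hab' ha hda
    hb hdb hpos
  simp only [stripFn_neg_iff hlt, stripFn_nonneg_iff hlt] at hev
  exact ⟨a - r, b + r, a + r, ⟨by linarith [hab.1], by linarith [hab.2]⟩,
    ⟨by linarith, by linarith⟩, hev⟩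

/-- The vertical segment of `exists_regular_box` meets every component near `ρ p₀`, and hence gives
the inverse of the level function. -/
theorem isLocalHomeomorphOn (h : IsSliceQuotient ρ f) (h₁ : ContDiff ℝ 1 c₁)
    (h₂ : ContDiff ℝ 1 c₂) (hlt : ∀ x, c₁ x < c₂ x) (hbox : HasBoxes c₁ c₂) :
    IsLocalHomeomorphOn f (ρ '' tangencies c₁ c₂)ᶜ := by
  intro y hy
  obtain ⟨p₀, rfl⟩ := h.isQuotientMap.surjective y
  obtain ⟨a, b, x₁, hx₀, hx₁, hev⟩ := h.exists_regular_box h₁ h₂ hlt hbox hy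
  obtain ⟨J, hJ, hJo, htJ⟩ := mem_nhds_iff.1 hev
  have hab : a < b := hx₀.1.trans hx₀.2
  have hends : ∀ s ∈ J, Disjoint (frontier (Ioo a b)) (slice c₁ c₂ s) := fun s hs => by
    simpa [frontier_Ioo hab] using ⟨(hJ hs).1, (hJ hs).2.1⟩
  have hmem : ∀ s ∈ J, (s, x₁) ∈ strip c₁ c₂ := fun s hs => (hJ hs).2.2.1
  let g : ℝ → Y := fun s => ρ (stripRetraction (fun x => (hlt x).le) (s, x₁))
  have hg : ∀ s (hs : s ∈ J), g s = ρ ⟨(s, x₁), hmem s hs⟩ := fun s hs =>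
    congrArg ρ (stripRetraction_of_mem _ (hmem s hs))
  have hgc : Continuous g := h.isQuotientMap.continuous.comp
    ((continuous_stripRetraction h₁.continuous h₂.continuous _).comp (by fun_prop))
  refine ⟨{ toFun := f, invFun := g, source := ρ '' {p | p.1.2 ∈ Ioo a b ∧ p.1.1 ∈ J}, target := J
            open_source := h.isOpen_image_box isOpen_Ioo hJo hends, open_target := hJo
            continuousOn_toFun := h.continuous.continuousOn
            continuousOn_invFun := hgc.continuousOn
            map_source' := ?_, map_target' := ?_, left_inv' := ?_, right_inv' := ?_ },
    ⟨p₀, ⟨hx₀, htJ⟩, rfl⟩, rfl⟩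
  · rintro _ ⟨p, hp, rfl⟩
    exact (h.level p).symm ▸ hp.2
  · exact fun s hs => ⟨_, ⟨hx₁, hs⟩, (hg s hs).symm⟩
  · rintro _ ⟨p, ⟨hp, hpJ⟩, rfl⟩
    rw [h.level, hg _ hpJ]
    exact (h.eq_iff _ _).2 ⟨rfl, ((hJ hpJ).2.2.2.uIcc_subset
      ⟨Ioo_subset_Icc_self hx₁, hmem _ hpJ⟩ ⟨Ioo_subset_Icc_self hp, p.2⟩).trans inter_subset_right⟩
  · exact fun s hs => by rw [hg s hs, h.level]

theorem isLevelFunction (h : IsSliceQuotient ρ f) (h₁ : ContDiff ℝ 1 c₁) (h₂ : ContDiff ℝ 1 c₂)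
    (hlt : ∀ x, c₁ x < c₂ x) (hbox : HasBoxes c₁ c₂) :
    IsLevelFunction f (ρ '' tangencies c₁ c₂) where
  continuous := h.continuous
  isLocalHomeomorphOn := h.isLocalHomeomorphOn h₁ h₂ hlt hbox
  exists_box y _ hO := h.exists_isIsolatingBox h₁.continuous h₂.continuous hbox y hO

end IsSliceQuotient

end StripQuotients

section Ends

/-- A filter with the properties of `atBot` and `atTop` on the line: it runs to infinity, and it is
generated by rays. -/
structure IsLineEnd (l : Filter ℝ) : Prop where
  neBot : l.NeBot
  le_cocompact : l ≤ cocompact ℝ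
  exists_ray : ∀ S ∈ l, ∃ b ∈ S, ∃ Q ∈ l, Q ⊆ S ∧ IsPreconnected Q ∧ frontier Q = {b}

theorem isLineEnd_atBot : IsLineEnd atBot where
  neBot := inferInstance
  le_cocompact := atBot_le_cocompact
  exists_ray S hS := by
    obtain ⟨b, hb⟩ := mem_atBot_sets.1 hS
    exact ⟨b, hb b le_rfl, Iic b, Iic_mem_atBot b, hb, isPreconnected_Iic, frontier_Iic⟩

theorem isLineEnd_atTop : IsLineEnd atTop where
  neBot := inferInstance
  le_cocompact := atTop_le_cocompact
  exists_ray S hS := by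
    obtain ⟨b, hb⟩ := mem_atTop_sets.1 hS
    exact ⟨b, hb b le_rfl, Ici b, Ici_mem_atTop b, hb, isPreconnected_Ici, frontier_Ici⟩

variable {c₁ c₂ : ℝ → ℝ}

/-- Along `l`, the boundary curves of the strip have no critical points and the strip avoids the
level `q`. -/
def HasRegularEnd (c₁ c₂ : ℝ → ℝ) (l : Filter ℝ) (q : ℝ) : Prop :=
  ∀ᶠ x in l, deriv c₁ x ≠ 0 ∧ deriv c₂ x ≠ 0 ∧ x ∉ slice c₁ c₂ q

/-- The filter on the strip of running to infinity along `l` while the level tends to `β`. -/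
def endFilter (c₁ c₂ : ℝ → ℝ) (l : Filter ℝ) (β : ℝ) : Filter (strip c₁ c₂) :=
  comap (fun p => p.1.2) l ⊓ comap (fun p => p.1.1) (𝓝 β)

theorem eq_of_neBot_endFilter {l : Filter ℝ} {β q : ℝ} [(endFilter c₁ c₂ l β).NeBot]
    (hq₁ : Tendsto c₁ l (𝓝 q)) (hq₂ : Tendsto c₂ l (𝓝 q)) : β = q := by
  have hl : Tendsto (fun p => p.1.2) (endFilter c₁ c₂ l β) l := tendsto_comap.mono_left inf_le_left
  have hβ : Tendsto (fun p => p.1.1) (endFilter c₁ c₂ l β) (𝓝 β) :=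
    tendsto_comap.mono_left inf_le_right
  exact tendsto_nhds_unique hβ (tendsto_of_tendsto_of_tendsto_of_le_of_le (hq₁.comp hl)
    (hq₂.comp hl) (fun p => p.2.1) fun p => p.2.2)

namespace IsSliceQuotient

variable {Y : Type*} [TopologicalSpace Y] {ρ : strip c₁ c₂ → Y} {f : Y → ℝ}

theorem connectedSpace (h : IsSliceQuotient ρ f) (h₁ : Continuous c₁) (h₂ : Continuous c₂)
    (hle : ∀ x, c₁ x ≤ c₂ x) : ConnectedSpace Y := by
  have hpre : IsPreconnected (univ : Set (strip c₁ c₂)) := by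
    simpa using isPreconnected_strip_over h₁ h₂ hle isPreconnected_univ
  rw [connectedSpace_iff_univ, ← h.isQuotientMap.surjective.range_eq, ← image_univ]
  exact ⟨⟨_, ⟨(c₁ 0, 0), le_rfl, hle 0⟩, mem_univ _, rfl⟩,
    hpre.image _ h.isQuotientMap.continuous.continuousOn⟩

theorem isBounded_range (h : IsSliceQuotient ρ f) (h₁ : Bornology.IsBounded (range c₁))
    (h₂ : Bornology.IsBounded (range c₂)) : Bornology.IsBounded (range f) := by
  obtain ⟨m, hm⟩ := h₁.bddBelow
  obtain ⟨M, hM⟩ := h₂.bddAbove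
  refine (Metric.isBounded_Icc m M).subset ?_
  rintro _ ⟨y, rfl⟩
  obtain ⟨p, rfl⟩ := h.isQuotientMap.surjective y
  rw [h.level]
  exact ⟨(hm ⟨_, rfl⟩).trans p.2.1, p.2.2.trans (hM ⟨_, rfl⟩)⟩

theorem not_mapClusterPt (h : IsSliceQuotient ρ f) (hbox : HasBoxes c₁ c₂) {ι : Type*}
    {l : Filter ι} {γ : ι → strip c₁ c₂} (hγ : Tendsto (fun i => (γ i).1.2) l (cocompact ℝ))
    (y : Y) : ¬ MapClusterPt y l (ρ ∘ γ) := by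
  intro hy
  obtain ⟨p, rfl⟩ := h.isQuotientMap.surjective y
  obtain ⟨a, b, hp, ha, hb, -⟩ := hbox _ _ p.2
  have hQJ : ∀ s ∈ {s | a ∉ slice c₁ c₂ s} ∩ {s | b ∉ slice c₁ c₂ s},
      Disjoint (frontier (Ioo a b)) (slice c₁ c₂ s) := fun s hs => by
    simpa [frontier_Ioo (hp.1.trans hp.2)] using hs
  have hfreq := hy.frequently ((h.isOpen_image_box isOpen_Ioo ((isOpen_setOf_notMem_slice a).inter
    (isOpen_setOf_notMem_slice b)) hQJ).mem_nhds ⟨p, ⟨hp, ha, hb⟩, rfl⟩)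
  obtain ⟨i, hi, hi'⟩ :=
    (hfreq.and_eventually (hγ.eventually isCompact_Icc.compl_mem_cocompact)).exists
  exact hi' (Ioo_subset_Icc_self ((h.mem_image_box_iff hQJ).1 hi).1)

theorem exists_not_isCompact_closure (h : IsSliceQuotient ρ f) (hbox : HasBoxes c₁ c₂) {V : Set Y}
    {ι : Type*} [TopologicalSpace ι] {l : Filter ι} [l.NeBot] {γ : ι → strip c₁ c₂}
    (hγ : Continuous γ) (hl : Tendsto (fun i => (γ i).1.2) l (cocompact ℝ)) {Q : Set ι}
    (hQl : Q ∈ l) (hQ : IsPreconnected Q) (hV : ∀ i ∈ Q, ρ (γ i) ∉ V) :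
    ∃ e ∈ edges V, ¬ IsCompact (closure e) := by
  obtain ⟨i₀, hi₀⟩ := Filter.nonempty_of_mem hQl
  refine ⟨_, ⟨ρ (γ i₀), hV i₀ hi₀, rfl⟩, fun hcpt => ?_⟩
  have hsub : ρ ∘ γ '' Q ⊆ connectedComponentIn Vᶜ (ρ (γ i₀)) :=
    (hQ.image _ (h.isQuotientMap.continuous.comp hγ).continuousOn).subset_connectedComponentIn
      ⟨i₀, hi₀, rfl⟩ (image_subset_iff.2 hV)
  obtain ⟨y, -, hy⟩ := hcpt.exists_mapClusterPt (f := l) (u := ρ ∘ γ) (le_principal_iff.2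
    (mem_of_superset (image_mem_map hQl) (hsub.trans subset_closure)))
  exact h.not_mapClusterPt hbox hl y hy

/-- Near the end, the components over a ray without critical points avoid the endpoint of the ray,
which is not in the slice at the limiting level. -/
theorem exists_not_isCompact_closure_of_hasRegularEnd (h : IsSliceQuotient ρ f)
    (hbox : HasBoxes c₁ c₂) (h₂ : Continuous c₂) (hle : ∀ x, c₁ x ≤ c₂ x) {l : Filter ℝ}
    (hl : IsLineEnd l) {q : ℝ} (hq : Tendsto c₂ l (𝓝 q)) (hreg : HasRegularEnd c₁ c₂ l q) :
    ∃ e ∈ edges (ρ '' tangencies c₁ c₂), ¬ IsCompact (closure e) := by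
  have := hl.neBot
  obtain ⟨b, ⟨-, -, hb⟩, Q, hQl, hQ, -, hbQ⟩ := hl.exists_ray _ hreg
  obtain ⟨-, -, R, hRl, hR, hRc, -⟩ :=
    hl.exists_ray _ (inter_mem hQl (hq.eventually (eventually_notMem_slice hb)))
  refine h.exists_not_isCompact_closure hbox (γ := fun x => ⟨(c₂ x, x), hle x, le_rfl⟩)
    (by fun_prop) hl.le_cocompact hRl hRc ?_
  rintro x hx ⟨p, hp, hpx⟩
  have hseg := ((h.eq_iff ⟨(c₂ x, x), hle x, le_rfl⟩ p).1 hpx.symm).2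
  have hpQ : p.1.2 ∈ Q := mem_of_uIcc_subset (by simpa [hbQ] using (hR hx).2) hseg (hR hx).1
  exact hp.elim (fun hp => (hQ hpQ).1 hp.2) fun hp => (hQ hpQ).2.1 hp.2

theorem frequently_endFilter (h : IsSliceQuotient ρ f) (h₁ : Continuous c₁) (h₂ : Continuous c₂)
    {e : Set Y} {β : ℝ} (hβ : β ∉ f '' closure e) (hβ' : β ∈ closure (f '' e)) :
    ∃ᶠ p in endFilter c₁ c₂ (atBot ⊔ atTop) β, ρ p ∈ e := by
  rw [← cocompact_eq_atBot_atTop, ← Metric.cobounded_eq_cocompact, endFilter,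
    (((Metric.hasBasis_cobounded_compl_closedBall (0 : ℝ)).comap _).inf
      (Metric.nhds_basis_closedBall.comap _)).frequently_iff]
  rintro ⟨M, ε⟩ ⟨-, hε⟩
  have hclosed : IsClosed (f '' (closure e ∩
      ρ '' {p | p.1.2 ∈ Icc (0 - M) (0 + M) ∧ p.1.1 ∈ Icc (β - ε) (β + ε)})) :=
    ((((isCompact_box h₁ h₂ _ _ _ _).image h.isQuotientMap.continuous).inter_left
      isClosed_closure).image h.continuous).isClosed
  obtain ⟨_, ⟨hw, hwε⟩, w, hwe, rfl⟩ := mem_closure_iff_nhds.1 hβ' _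
    (inter_mem (hclosed.isOpen_compl.mem_nhds
      fun hmem => hβ (image_mono inter_subset_left hmem)) (Metric.closedBall_mem_nhds β hε))
  obtain ⟨p, rfl⟩ := h.isQuotientMap.surjective w
  rw [h.level] at hwε
  refine ⟨p, ⟨fun hM => hw ⟨ρ p, ⟨subset_closure hwe, p, ?_, rfl⟩, rfl⟩, hwε⟩, hwe⟩
  simp only [Real.closedBall_eq_Icc] at hM hwε
  exact ⟨hM, hwε⟩

end IsSliceQuotient

theorem IsLevelFunction.mem_image_edge {Y : Type*} [TopologicalSpace Y] {f : Y → ℝ} {V e : Set Y}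
    (h : IsLevelFunction f V) (he : e ∈ edges V) {β : ℝ} (hβ : β ∉ f '' closure e)
    (hβ' : β ∈ closure (f '' e)) {w : Y} (hw : w ∈ e) {t : ℝ} (ht : t ∈ f '' closure e)
    (htw : |t - β| < |f w - β|) : t ∈ f '' e := by
  have hE := h.ordConnected_image_edge he
  have hT := h.ordConnected_image_closure_edge he
  have hwE : f w ∈ f '' e := mem_image_of_mem f hw
  have hwT : f w ∈ f '' closure e := image_mono subset_closure hwE
  have hne : f w ≠ β := fun hwβ => hβ (hwβ ▸ hwT)
  rcases hne.lt_or_gt with hlt | hgt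
  · have htβ : t < β := lt_of_not_ge fun hβt => hβ (hT.out hwT ht ⟨hlt.le, hβt⟩)
    rw [abs_of_neg (sub_neg.2 hlt), abs_of_neg (sub_neg.2 htβ)] at htw
    obtain ⟨s, hts, hs⟩ := mem_closure_iff_nhds.1 hβ' _ (Ioi_mem_nhds htβ)
    exact hE.out hwE hs ⟨by linarith, le_of_lt hts⟩
  · have htβ : β < t := lt_of_not_ge fun hβt => hβ (hT.out ht hwT ⟨hβt, hgt.le⟩)
    rw [abs_of_pos (sub_pos.2 hgt), abs_of_pos (sub_pos.2 htβ)] at htw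
    obtain ⟨s, hst, hs⟩ := mem_closure_iff_nhds.1 hβ' _ (Iio_mem_nhds htβ)
    exact hE.out hs hwE ⟨le_of_lt hst, by linarith⟩

namespace IsSliceQuotient

variable {Y : Type*} [TopologicalSpace Y] [T2Space Y] {ρ : strip c₁ c₂ → Y} {f : Y → ℝ}
  {V e : Set Y}

/-- By connectedness, the strip over an interval on which the boundary curves are close to the end
`β` of the edge `e` is mapped into `e` or into its complement. -/
theorem forall_mem_edge (h : IsSliceQuotient ρ f) (hL : IsLevelFunction f V)
    (h₁ : Continuous c₁) (h₂ : Continuous c₂) (hle : ∀ x, c₁ x ≤ c₂ x) (he : e ∈ edges V)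
    {β : ℝ} (hβ : β ∉ f '' closure e) (hβ' : β ∈ closure (f '' e)) {w : Y} (hw : w ∈ e)
    {Q : Set ℝ} (hQ : IsPreconnected Q)
    (hQβ : ∀ x ∈ Q, |c₁ x - β| < |f w - β| ∧ |c₂ x - β| < |f w - β|)
    (hex : ∃ p, p.1.2 ∈ Q ∧ ρ p ∈ e) {p : strip c₁ c₂} (hp : p.1.2 ∈ Q) : ρ p ∈ e := by
  refine (isPreconnected_strip_over h₁ h₂ hle hQ).subset_of_closure_inter_subset
    ((hL.isOpen_edge he).preimage h.isQuotientMap.continuous) hex ?_ hp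
  rintro r ⟨hr, hrQ⟩
  have hre : ρ r ∈ closure e := h.isQuotientMap.continuous.closure_preimage_subset _ hr
  obtain ⟨hd₁, hd₂⟩ := hQβ _ hrQ
  have hdist : |f (ρ r) - β| < |f w - β| := by
    rw [h.level, abs_lt]
    exact ⟨by linarith [(abs_lt.1 hd₁).1, r.2.1], by linarith [(abs_lt.1 hd₂).2, r.2.2]⟩
  obtain ⟨w', hw', hlevel⟩ :=
    hL.mem_image_edge he hβ hβ' hw (mem_image_of_mem f hre) hdist
  rw [mem_preimage, ← hL.injOn_closure_edge he (subset_closure hw') hre hlevel]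
  exact hw'

theorem eventually_mem_edge (h : IsSliceQuotient ρ f) (hL : IsLevelFunction f V)
    (h₁ : Continuous c₁) (h₂ : Continuous c₂) (hle : ∀ x, c₁ x ≤ c₂ x) (he : e ∈ edges V)
    {β : ℝ} (hβ : β ∉ f '' closure e) (hβ' : β ∈ closure (f '' e)) {l : Filter ℝ}
    (hl : IsLineEnd l) (hβ₁ : Tendsto c₁ l (𝓝 β)) (hβ₂ : Tendsto c₂ l (𝓝 β))
    (hfreq : ∃ᶠ p in endFilter c₁ c₂ l β, ρ p ∈ e) :
    ∀ᶠ p in comap (fun p : strip c₁ c₂ => p.1.2) l, ρ p ∈ e := by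
  obtain ⟨w, hw⟩ := (isConnected_edge he).nonempty
  have hη : 0 < |f w - β| :=
    abs_pos.2 (sub_ne_zero.2 fun hwβ => hβ (hwβ ▸ mem_image_of_mem f (subset_closure hw)))
  obtain ⟨-, -, Q, hQl, hQ, hQc, -⟩ := hl.exists_ray _
    (inter_mem (hβ₁ (Metric.ball_mem_nhds β hη)) (hβ₂ (Metric.ball_mem_nhds β hη)))
  have hQl' : {p : strip c₁ c₂ | p.1.2 ∈ Q} ∈ comap (fun p : strip c₁ c₂ => p.1.2) l :=
    preimage_mem_comap hQl
  obtain ⟨p, hpe, hpQ⟩ := (hfreq.and_eventually (mem_inf_of_left hQl')).exists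
  filter_upwards [hQl'] with r hr
  exact h.forall_mem_edge hL h₁ h₂ hle he hβ hβ' hw hQc (fun x hx => hQ hx) ⟨p, hpQ, hpe⟩ hr

theorem hasRegularEnd (h : IsSliceQuotient ρ f)
    (hL : IsLevelFunction f (ρ '' tangencies c₁ c₂)) (h₁ : Continuous c₁) (h₂ : Continuous c₂)
    (hle : ∀ x, c₁ x ≤ c₂ x) (he : e ∈ edges (ρ '' tangencies c₁ c₂)) {β q : ℝ}
    (hβ : β ∉ f '' closure e) (hβ' : β ∈ closure (f '' e)) {l : Filter ℝ} (hl : IsLineEnd l)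
    (hq₁ : Tendsto c₁ l (𝓝 q)) (hq₂ : Tendsto c₂ l (𝓝 q))
    (hfreq : ∃ᶠ p in endFilter c₁ c₂ l β, ρ p ∈ e) : HasRegularEnd c₁ c₂ l q := by
  have : (endFilter c₁ c₂ l β).NeBot := ⟨fun hbot => by simp [hbot] at hfreq⟩
  obtain rfl : β = q := eq_of_neBot_endFilter hq₁ hq₂
  filter_upwards [eventually_comap.1
    (h.eventually_mem_edge hL h₁ h₂ hle he hβ hβ' hl hq₁ hq₂ hfreq)] with x hx
  have hV := edge_subset_compl he
  refine ⟨fun hd => ?_, fun hd => ?_, fun hxβ => ?_⟩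
  · exact hV (hx ⟨(c₁ x, x), le_rfl, hle x⟩ rfl) ⟨_, Or.inl ⟨rfl, hd⟩, rfl⟩
  · exact hV (hx ⟨(c₂ x, x), hle x, le_rfl⟩ rfl) ⟨_, Or.inr ⟨rfl, hd⟩, rfl⟩
  · exact hβ ⟨_, subset_closure (hx ⟨(β, x), hxβ⟩ rfl), h.level _⟩

theorem forall_isCompact_closure_iff (h : IsSliceQuotient ρ f)
    (hL : IsLevelFunction f (ρ '' tangencies c₁ c₂)) (h₁ : Continuous c₁) (h₂ : Continuous c₂)
    (hle : ∀ x, c₁ x ≤ c₂ x) (hbox : HasBoxes c₁ c₂) (hb : Bornology.IsBounded (range f))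
    {q₁ q₂ : ℝ} (hbot₁ : Tendsto c₁ atBot (𝓝 q₁)) (hbot₂ : Tendsto c₂ atBot (𝓝 q₁))
    (htop₁ : Tendsto c₁ atTop (𝓝 q₂)) (htop₂ : Tendsto c₂ atTop (𝓝 q₂)) :
    (∀ e ∈ edges (ρ '' tangencies c₁ c₂), IsCompact (closure e)) ↔
      ¬ HasRegularEnd c₁ c₂ atBot q₁ ∧ ¬ HasRegularEnd c₁ c₂ atTop q₂ := by
  constructor
  · intro hcompact
    have hends : ∀ {l q}, IsLineEnd l → Tendsto c₂ l (𝓝 q) → ¬ HasRegularEnd c₁ c₂ l q := by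
      intro l q hl hq hreg
      obtain ⟨e, he, hne⟩ :=
        h.exists_not_isCompact_closure_of_hasRegularEnd hbox h₂ hle hl hq hreg
      exact hne (hcompact e he)
    exact ⟨hends isLineEnd_atBot hbot₂, hends isLineEnd_atTop htop₂⟩
  · rintro ⟨hbot, htop⟩ e he
    by_contra hne
    obtain ⟨β, hβ, hβ'⟩ := hL.exists_end_of_not_isCompact hb he hne
    have hfreq := h.frequently_endFilter h₁ h₂ hβ hβ'
    rw [endFilter, comap_sup, inf_sup_right, frequently_sup] at hfreq
    rcases hfreq with hfreq | hfreq
    · exact hbot (h.hasRegularEnd hL h₁ h₂ hle he hβ hβ' isLineEnd_atBot hbot₁ hbot₂ hfreq)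
    · exact htop (h.hasRegularEnd hL h₁ h₂ hle he hβ hβ' isLineEnd_atTop htop₁ htop₂ hfreq)

end IsSliceQuotient

end Ends

section Derivatives

variable {E F : Type*} [NormedAddCommGroup E] [NormedSpace ℝ E] [NormedAddCommGroup F]
  [NormedSpace ℝ F]

theorem hasDerivAt_fst_comp {γ : ℝ → E × F} {v : E × F} {t : ℝ} (h : HasDerivAt γ v t) :
    HasDerivAt (fun τ => (γ τ).1) v.1 t :=
  HasFDerivAt.comp_hasDerivAt (l := (Prod.fst : E × F → E)) t
    (ContinuousLinearMap.fst ℝ E F).hasFDerivAt h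

theorem hasDerivAt_snd_comp {γ : ℝ → E × F} {v : E × F} {t : ℝ} (h : HasDerivAt γ v t) :
    HasDerivAt (fun τ => (γ τ).2) v.2 t :=
  HasFDerivAt.comp_hasDerivAt (l := (Prod.snd : E × F → F)) t
    (ContinuousLinearMap.snd ℝ E F).hasFDerivAt h

theorem hasDerivAt_sum_sq {ι : Type*} [Fintype ι] {y : ℝ → ι → ℝ} {y' : ι → ℝ} {t : ℝ}
    (h : HasDerivAt y y' t) :
    HasDerivAt (fun τ => ∑ j, y τ j ^ 2) (∑ j, 2 * y t j * y' j) t :=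
  HasDerivAt.fun_sum fun j _ => by simpa using (hasDerivAt_pi.1 h j).fun_pow 2

theorem hasDerivAt_stripFn_comp {c₁ c₂ σ ξ : ℝ → ℝ} {σ' ξ' t : ℝ} (h₁ : Differentiable ℝ c₁)
    (h₂ : Differentiable ℝ c₂) (hσ : HasDerivAt σ σ' t) (hξ : HasDerivAt ξ ξ' t) :
    HasDerivAt (fun τ => stripFn c₁ c₂ (σ τ) (ξ τ))
      (σ' * (c₁ (ξ t) + c₂ (ξ t) - 2 * σ t) + stripDeriv c₁ c₂ (σ t) (ξ t) * ξ') t := by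
  have e₁ : HasDerivAt (fun τ => c₁ (ξ τ)) (deriv c₁ (ξ t) * ξ') t :=
    (h₁ (ξ t)).hasDerivAt.comp t hξ
  have e₂ : HasDerivAt (fun τ => c₂ (ξ τ)) (deriv c₂ (ξ t) * ξ') t :=
    (h₂ (ξ t)).hasDerivAt.comp t hξ
  refine ((hσ.fun_sub e₁).fun_mul (e₂.fun_sub hσ)).congr_deriv ?_
  unfold stripDeriv
  ring

end Derivatives

section Manifold

variable {m : ℕ} {c₁ c₂ : ℝ → ℝ}

theorem mem_closure_region_of_mem_slice (hlt : ∀ x, c₁ x < c₂ x) {s x : ℝ}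
    (h : x ∈ slice c₁ c₂ s) : (s, x) ∈ closure (region c₁ c₂) := by
  have hs : s ∈ closure (Ioo (c₁ x) (c₂ x)) := by
    rw [closure_Ioo (hlt x).ne]
    exact h
  have hcont : Continuous fun s : ℝ => (s, x) := by fun_prop
  exact closure_mono (by rintro _ ⟨s', hs', rfl⟩; exact hs')
    (image_closure_subset_closure_image hcont ⟨s, hs, rfl⟩)

theorem mem_manifoldX_iff (hlt : ∀ x, c₁ x < c₂ x) {p : Ambient m} :
    p ∈ manifoldX m c₁ c₂ ↔ stripFn c₁ c₂ p.1 p.2.1 = ∑ j, p.2.2 j ^ 2 := by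
  refine ⟨fun h => sub_eq_zero.1 h.2, fun h => ⟨?_, sub_eq_zero.2 h⟩⟩
  refine mem_closure_region_of_mem_slice hlt ((stripFn_nonneg_iff hlt).1 ?_)
  exact h ▸ Finset.sum_nonneg fun _ _ => sq_nonneg _

theorem stripFn_eq_sum_sq (p : manifoldX m c₁ c₂) :
    stripFn c₁ c₂ p.1.1 p.1.2.1 = ∑ j, p.1.2.2 j ^ 2 :=
  sub_eq_zero.1 p.2.2

theorem stripFn_nonneg_of_mem_manifoldX (p : manifoldX m c₁ c₂) :
    0 ≤ stripFn c₁ c₂ p.1.1 p.1.2.1 :=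
  stripFn_eq_sum_sq p ▸ Finset.sum_nonneg fun _ _ => sq_nonneg _

theorem mem_slice_of_mem_manifoldX (hlt : ∀ x, c₁ x < c₂ x) (p : manifoldX m c₁ c₂) :
    p.1.2.1 ∈ slice c₁ c₂ p.1.1 :=
  (stripFn_nonneg_iff hlt).1 (stripFn_nonneg_of_mem_manifoldX p)

theorem fibre_eq_zero_of_stripFn_eq_zero {p : manifoldX m c₁ c₂}
    (h : stripFn c₁ c₂ p.1.1 p.1.2.1 = 0) : p.1.2.2 = 0 := by
  have hp := stripFn_eq_sum_sq p
  rw [h, eq_comm, Finset.sum_eq_zero_iff_of_nonneg fun _ _ => sq_nonneg _] at hp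
  funext j
  simpa using hp j (Finset.mem_univ j)

theorem lift_mem_manifoldX (hlt : ∀ x, c₁ x < c₂ x) {u : Fin (m - 1) → ℝ}
    (hu : ∑ j, u j ^ 2 = 1) {s x : ℝ} (h : x ∈ slice c₁ c₂ s) :
    ((s, x, √(stripFn c₁ c₂ s x) • u) : Ambient m) ∈ manifoldX m c₁ c₂ := by
  rw [mem_manifoldX_iff hlt]
  simp only [Pi.smul_apply, smul_eq_mul, mul_pow, ← Finset.mul_sum, hu, mul_one]
  rw [Real.sq_sqrt ((stripFn_nonneg_iff hlt).2 h)]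

theorem exists_eq_lift {u₀ : Fin (m - 1) → ℝ} (hu₀ : ∑ j, u₀ j ^ 2 = 1)
    (p : manifoldX m c₁ c₂) :
    ∃ u : Fin (m - 1) → ℝ, ∑ j, u j ^ 2 = 1 ∧
      p.1 = (p.1.1, p.1.2.1, √(stripFn c₁ c₂ p.1.1 p.1.2.1) • u) := by
  have hnn := stripFn_nonneg_of_mem_manifoldX p
  rcases hnn.eq_or_lt with h0 | hpos
  · refine ⟨u₀, hu₀, Prod.ext rfl (Prod.ext rfl ?_)⟩
    simp only [← h0, Real.sqrt_zero, zero_smul, fibre_eq_zero_of_stripFn_eq_zero h0.symm]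
  · have hne : √(stripFn c₁ c₂ p.1.1 p.1.2.1) ≠ 0 := (Real.sqrt_pos.2 hpos).ne'
    refine ⟨(√(stripFn c₁ c₂ p.1.1 p.1.2.1))⁻¹ • p.1.2.2, ?_, Prod.ext rfl (Prod.ext rfl ?_)⟩
    · simp only [Pi.smul_apply, smul_eq_mul, mul_pow, ← Finset.mul_sum, ← stripFn_eq_sum_sq,
        inv_pow]
      rw [Real.sq_sqrt hnn, inv_mul_cancel₀ hpos.ne']
    · exact (smul_inv_smul₀ hne _).symm

theorem continuous_projX : Continuous (projX m c₁ c₂) := by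
  unfold projX proj
  fun_prop

theorem fderiv_proj (p v : Ambient m) : fderiv ℝ (proj m) p v = v.1 :=
  congrArg (· v) (ContinuousLinearMap.fst ℝ ℝ (ℝ × (Fin (m - 1) → ℝ))).fderiv

theorem mem_critX_of_isTangency (h₁ : Differentiable ℝ c₁) (h₂ : Differentiable ℝ c₂)
    (hlt : ∀ x, c₁ x < c₂ x) {p : manifoldX m c₁ c₂}
    (h : IsTangency c₁ c₂ p.1.1 p.1.2.1) : p ∈ critX m c₁ c₂ := by
  rintro v ⟨ε, hε, γ, -, hγ, hγ0, hγv⟩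
  rw [fderiv_proj]
  obtain ⟨hF, hdF⟩ := (isTangency_iff hlt).1 h
  have hy := fibre_eq_zero_of_stripFn_eq_zero hF
  have hleft := hasDerivAt_stripFn_comp h₁ h₂ (hasDerivAt_fst_comp hγv)
    (hasDerivAt_fst_comp (hasDerivAt_snd_comp hγv))
  have hright := hasDerivAt_sum_sq (hasDerivAt_snd_comp (hasDerivAt_snd_comp hγv))
  have heq : (fun τ => stripFn c₁ c₂ (γ τ).1 (γ τ).2.1) =ᶠ[𝓝 0]
      fun τ => ∑ j, (γ τ).2.2 j ^ 2 := by
    filter_upwards [Ioo_mem_nhds (neg_lt_zero.2 hε) hε] with τ hτ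
    exact stripFn_eq_sum_sq ⟨γ τ, hγ τ hτ⟩
  have hd := hleft.unique (hright.congr_of_eventuallyEq heq)
  simp only [hγ0, hy, hdF, Pi.zero_apply, mul_zero, zero_mul, add_zero, Finset.sum_const_zero] at hd
  refine (mul_eq_zero.1 hd).resolve_right ?_
  have hx := hlt p.1.2.1
  rcases h with ⟨hs, -⟩ | ⟨hs, -⟩
  · linarith
  · linarith

theorem deriv_fst_eq_zero_of_mem_critX {p : manifoldX m c₁ c₂} (h : p ∈ critX m c₁ c₂)
    {ε d : ℝ} (hε : 0 < ε) {γ : ℝ → Ambient m} (hγ : ContDiffOn ℝ ∞ γ (Ioo (-ε) ε))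
    (hγX : ∀ s ∈ Ioo (-ε) ε, γ s ∈ manifoldX m c₁ c₂) (hγ0 : γ 0 = p)
    (hd : HasDerivAt (fun s => (γ s).1) d 0) : d = 0 := by
  have hdiff : DifferentiableAt ℝ γ 0 :=
    (hγ.contDiffAt (Ioo_mem_nhds (neg_lt_zero.2 hε) hε)).differentiableAt (by simp)
  have hv := h (deriv γ 0) ⟨ε, hε, γ, hγ, hγX, hγ0, hdiff.hasDerivAt⟩
  rw [fderiv_proj] at hv
  rw [hd.unique (hasDerivAt_fst_comp hdiff.hasDerivAt), hv]

theorem deriv_eq_zero_of_mem_critX (hlt : ∀ x, c₁ x < c₂ x) {p : manifoldX m c₁ c₂}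
    (h : p ∈ critX m c₁ c₂) {c : ℝ → ℝ} (hc : ContDiff ℝ ∞ c)
    (hF : ∀ w, stripFn c₁ c₂ (c w) w = 0) (hp : c p.1.2.1 = p.1.1) : deriv c p.1.2.1 = 0 := by
  refine deriv_fst_eq_zero_of_mem_critX
    (γ := fun τ => (c (p.1.2.1 + τ), p.1.2.1 + τ, 0)) h one_pos (by fun_prop) ?_ ?_ ?_
  · intro τ _
    rw [mem_manifoldX_iff hlt]
    simp [hF]
  · have hy := fibre_eq_zero_of_stripFn_eq_zero (hp ▸ hF p.1.2.1)
    simp only [add_zero, hp, ← hy]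
  · simpa using (hc.differentiable (by simp) (p.1.2.1 + 0)).hasDerivAt.comp_const_add p.1.2.1 0

-- Away from the boundary of the strip, rescaling the fibre coordinate compensates for a change of
-- the level, so that a curve in the manifold moves with unit speed in the direction of `proj`.
theorem stripFn_eq_zero_of_mem_critX (h₁ : Continuous c₁) (h₂ : Continuous c₂)
    (hlt : ∀ x, c₁ x < c₂ x) {p : manifoldX m c₁ c₂} (h : p ∈ critX m c₁ c₂) :
    stripFn c₁ c₂ p.1.1 p.1.2.1 = 0 := by
  by_contra hne
  have hpos : 0 < stripFn c₁ c₂ p.1.1 p.1.2.1 :=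
    (stripFn_nonneg_of_mem_manifoldX p).lt_of_ne' hne
  set φ : ℝ → ℝ := fun τ => stripFn c₁ c₂ (p.1.1 + τ) p.1.2.1 with hφ
  have hφ0 : φ 0 = stripFn c₁ c₂ p.1.1 p.1.2.1 := by simp [hφ]
  have hcont : Continuous φ := (continuous_stripFn h₁ h₂).comp
    (by fun_prop : Continuous fun τ => (p.1.1 + τ, p.1.2.1))
  obtain ⟨ε, hε, H⟩ := Metric.eventually_nhds_iff.1
    (hcont.continuousAt.eventually (lt_mem_nhds (hφ0 ▸ hpos)))
  have H' : ∀ τ ∈ Ioo (-ε) ε, 0 < φ τ := fun τ hτ =>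
    H (by rw [Real.dist_eq, sub_zero, abs_lt]; exact hτ)
  have hsm : ContDiffOn ℝ ∞ (fun τ => √(φ τ / φ 0)) (Ioo (-ε) ε) := by
    refine ContDiffOn.sqrt ?_ fun τ hτ => (div_pos (H' τ hτ) (hφ0 ▸ hpos)).ne'
    simp only [hφ, stripFn]
    fun_prop
  refine one_ne_zero (deriv_fst_eq_zero_of_mem_critX
    (γ := fun τ => (p.1.1 + τ, p.1.2.1, √(φ τ / φ 0) • p.1.2.2)) h hε ?_ ?_ ?_ ?_)
  · exact ContDiffOn.prodMk (by fun_prop) (ContDiffOn.prodMk (by fun_prop)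
      (hsm.smul contDiffOn_const))
  · intro τ hτ
    rw [mem_manifoldX_iff hlt]
    simp only [Pi.smul_apply, smul_eq_mul, mul_pow, ← Finset.mul_sum, ← stripFn_eq_sum_sq, ← hφ0]
    rw [Real.sq_sqrt (div_pos (H' τ hτ) (hφ0 ▸ hpos)).le, div_mul_cancel₀ _ (hφ0 ▸ hpos).ne']
  · simp [div_self (hφ0 ▸ hpos).ne']
  · simpa using (hasDerivAt_id (0 : ℝ)).const_add p.1.1

theorem isTangency_of_mem_critX (h₁ : ContDiff ℝ ∞ c₁) (h₂ : ContDiff ℝ ∞ c₂)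
    (hlt : ∀ x, c₁ x < c₂ x) {p : manifoldX m c₁ c₂} (h : p ∈ critX m c₁ c₂) :
    IsTangency c₁ c₂ p.1.1 p.1.2.1 := by
  rcases mul_eq_zero.1 (stripFn_eq_zero_of_mem_critX h₁.continuous h₂.continuous hlt h)
    with h' | h'
  · have hp := (sub_eq_zero.1 h').symm
    exact Or.inl ⟨hp, deriv_eq_zero_of_mem_critX hlt h h₁ (by simp [stripFn]) hp⟩
  · have hp := sub_eq_zero.1 h'
    exact Or.inr ⟨hp, deriv_eq_zero_of_mem_critX hlt h h₂ (by simp [stripFn]) hp⟩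

end Manifold

section Contours

section General

variable {X : Type*} [TopologicalSpace X] {f : X → ℝ} {x y : X}

theorem mem_contour (f : X → ℝ) (x : X) : x ∈ contour f x :=
  mem_connectedComponentIn rfl

theorem level_eq_of_mem_contour (h : y ∈ contour f x) : f y = f x :=
  connectedComponentIn_subset (f ⁻¹' {f x}) x h

theorem contour_eq_of_mem (h : y ∈ contour f x) : contour f y = contour f x := by
  rw [contour, level_eq_of_mem_contour h]
  exact (connectedComponentIn_eq h).symm

theorem contour_eq_of_isPreconnected {S : Set X} (hS : IsPreconnected S) (hx : x ∈ S)
    (hy : y ∈ S) (hf : ∀ z ∈ S, f z = f x) : contour f x = contour f y :=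
  (contour_eq_of_mem (hS.subset_connectedComponentIn hx hf hy)).symm

/-- The function on the Reeb space of `f` through which `f` factors. -/
def reebLevel (f : X → ℝ) : ReebSpace f → ℝ :=
  Quotient.lift f fun x y (h : contour f x = contour f y) =>
    (level_eq_of_mem_contour (h ▸ mem_contour f y : y ∈ contour f x)).symm

end General

variable {m : ℕ} {c₁ c₂ : ℝ → ℝ} {u : Fin (m - 1) → ℝ}

/-- The section, in the direction of the unit vector `u` of the fibres, of the projection of the
manifold to the strip. -/
noncomputable def lift (hlt : ∀ x, c₁ x < c₂ x) (hu : ∑ j, u j ^ 2 = 1) (p : strip c₁ c₂) :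
    manifoldX m c₁ c₂ :=
  ⟨(p.1.1, p.1.2, √(stripFn c₁ c₂ p.1.1 p.1.2) • u), lift_mem_manifoldX hlt hu p.2⟩

theorem continuous_lift (h₁ : Continuous c₁) (h₂ : Continuous c₂) (hlt : ∀ x, c₁ x < c₂ x)
    (hu : ∑ j, u j ^ 2 = 1) : Continuous (lift hlt hu) := by
  have hcont : Continuous fun p : strip c₁ c₂ => stripFn c₁ c₂ p.1.1 p.1.2 :=
    (continuous_stripFn h₁ h₂).comp continuous_subtype_val
  exact Continuous.subtype_mk (by fun_prop) _

/-- The projection of the manifold to the strip. -/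
def toStrip (hlt : ∀ x, c₁ x < c₂ x) (p : manifoldX m c₁ c₂) : strip c₁ c₂ :=
  ⟨(p.1.1, p.1.2.1), mem_slice_of_mem_manifoldX hlt p⟩

theorem continuous_toStrip (hlt : ∀ x, c₁ x < c₂ x) :
    Continuous (toStrip (m := m) hlt) :=
  Continuous.subtype_mk (by fun_prop) _

theorem contour_lift_eq (h₁ : Continuous c₁) (h₂ : Continuous c₂) (hlt : ∀ x, c₁ x < c₂ x)
    (hu : ∑ j, u j ^ 2 = 1) {p q : strip c₁ c₂} (hl : p.1.1 = q.1.1)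
    (hs : uIcc p.1.2 q.1.2 ⊆ slice c₁ c₂ p.1.1) :
    contour (projX m c₁ c₂) (lift hlt hu p) = contour (projX m c₁ c₂) (lift hlt hu q) := by
  set g : uIcc p.1.2 q.1.2 → strip c₁ c₂ := fun x => ⟨(p.1.1, x.1), hs x.2⟩ with hg
  have hgc : Continuous g := Continuous.subtype_mk (by fun_prop) _
  have hconn : PreconnectedSpace (uIcc p.1.2 q.1.2) :=
    isPreconnected_iff_preconnectedSpace.1 isPreconnected_uIcc
  refine contour_eq_of_isPreconnected (S := range fun x => lift hlt hu (g x))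
    (isPreconnected_range ((continuous_lift h₁ h₂ hlt hu).comp hgc))
    ⟨⟨p.1.2, left_mem_uIcc⟩, rfl⟩ ⟨⟨q.1.2, right_mem_uIcc⟩, ?_⟩ ?_
  · simp only [hg, hl]
  · rintro _ ⟨x, rfl⟩
    rfl

theorem uIcc_subset_of_contour_eq (hlt : ∀ x, c₁ x < c₂ x) {p q : manifoldX m c₁ c₂}
    (h : contour (projX m c₁ c₂) p = contour (projX m c₁ c₂) q) :
    p.1.1 = q.1.1 ∧ uIcc p.1.2.1 q.1.2.1 ⊆ slice c₁ c₂ p.1.1 := by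
  have hq : q ∈ contour (projX m c₁ c₂) p := h ▸ mem_contour _ q
  refine ⟨(level_eq_of_mem_contour hq).symm, ?_⟩
  have hpre : IsPreconnected ((fun r : manifoldX m c₁ c₂ => r.1.2.1) ''
      contour (projX m c₁ c₂) p) :=
    isPreconnected_connectedComponentIn.image _ (by fun_prop)
  refine (hpre.ordConnected.uIcc_subset ⟨p, mem_contour _ p, rfl⟩ ⟨q, hq, rfl⟩).trans ?_
  rintro _ ⟨r, hr, rfl⟩
  have hrp : r.1.1 = p.1.1 := level_eq_of_mem_contour (f := projX m c₁ c₂) hr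
  exact hrp ▸ mem_slice_of_mem_manifoldX hlt r

theorem HasBoxes.exists_gt_notMem_slice (hbox : HasBoxes c₁ c₂) {s x : ℝ}
    (hx : x ∈ slice c₁ c₂ s) : ∃ b > x, b ∉ slice c₁ c₂ s := by
  obtain ⟨_, b, hxb, -, hb, -⟩ := hbox s x hx
  exact ⟨b, hxb.2, hb⟩

theorem exists_uIcc_subset_slice_stripFn_eq_zero (h₁ : Continuous c₁) (h₂ : Continuous c₂)
    (hlt : ∀ x, c₁ x < c₂ x) {s x b' : ℝ} (hx : x ∈ slice c₁ c₂ s) (hxb : x < b')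
    (hb' : b' ∉ slice c₁ c₂ s) : ∃ b, uIcc x b ⊆ slice c₁ c₂ s ∧ stripFn c₁ c₂ s b = 0 := by
  obtain ⟨b, hb, hb0, hnn, -⟩ := exists_right_end (φ := stripFn c₁ c₂ s)
    ((continuous_stripFn h₁ h₂).comp (by fun_prop : Continuous fun x => (s, x)))
    ((stripFn_neg_iff hlt).2 hb') hxb ((stripFn_nonneg_iff hlt).2 hx)
  refine ⟨b, ?_, hb0⟩
  rw [uIcc_of_le hb.1]
  exact fun w hw => (stripFn_nonneg_iff hlt).1 (hnn w hw)

-- The fibre over the end of the component of a slice is a single point, so that any two directions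
-- of the fibres can be joined there.
theorem contour_lift_toStrip (h₁ : Continuous c₁) (h₂ : Continuous c₂) (hlt : ∀ x, c₁ x < c₂ x)
    (hbox : HasBoxes c₁ c₂) (hu : ∑ j, u j ^ 2 = 1) (p : manifoldX m c₁ c₂) :
    contour (projX m c₁ c₂) (lift hlt hu (toStrip hlt p)) = contour (projX m c₁ c₂) p := by
  obtain ⟨u', hu', hp⟩ := exists_eq_lift hu p
  have hp' : p = lift hlt hu' (toStrip hlt p) := Subtype.ext hp
  have hx := mem_slice_of_mem_manifoldX hlt p
  obtain ⟨b', hxb, hb'⟩ := hbox.exists_gt_notMem_slice hx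
  obtain ⟨b, hsub, hb0⟩ := exists_uIcc_subset_slice_stripFn_eq_zero h₁ h₂ hlt hx hxb hb'
  set q : strip c₁ c₂ := ⟨(p.1.1, b), hsub right_mem_uIcc⟩ with hq
  have hlift : lift hlt hu q = lift hlt hu' q := by
    refine Subtype.ext ?_
    simp only [lift, hq, hb0, Real.sqrt_zero, zero_smul]
  conv_rhs => rw [hp']
  rw [contour_lift_eq h₁ h₂ hlt hu (p := toStrip hlt p) (q := q) rfl hsub, hlift,
    contour_lift_eq h₁ h₂ hlt hu' (p := toStrip hlt p) (q := q) rfl hsub]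

/-- The map of the strip to the Reeb space given by the section `lift`. -/
noncomputable def toReeb (hlt : ∀ x, c₁ x < c₂ x) (hu : ∑ j, u j ^ 2 = 1) (p : strip c₁ c₂) :
    ReebSpace (projX m c₁ c₂) :=
  Quotient.mk (contourSetoid (projX m c₁ c₂)) (lift hlt hu p)

theorem isSliceQuotient_toReeb (h₁ : Continuous c₁) (h₂ : Continuous c₂)
    (hlt : ∀ x, c₁ x < c₂ x) (hbox : HasBoxes c₁ c₂) (hu : ∑ j, u j ^ 2 = 1) :
    IsSliceQuotient (toReeb hlt hu) (reebLevel (projX m c₁ c₂)) where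
  isQuotientMap := by
    have hcomp : toReeb hlt hu ∘ toStrip hlt = Quotient.mk (contourSetoid (projX m c₁ c₂)) :=
      funext fun p => Quotient.sound (contour_lift_toStrip h₁ h₂ hlt hbox hu p)
    refine IsQuotientMap.of_comp (continuous_toStrip (m := m) hlt)
      (continuous_quotient_mk'.comp (continuous_lift h₁ h₂ hlt hu)) ?_
    rw [hcomp]
    exact isQuotientMap_quotient_mk'
  level p := rfl
  eq_iff p q := by
    constructor
    · intro h
      exact uIcc_subset_of_contour_eq hlt (Quotient.exact h)
    · rintro ⟨hl, hs⟩
      exact Quotient.sound (contour_lift_eq h₁ h₂ hlt hu hl hs)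

theorem contoursMeeting_critX (h₁ : ContDiff ℝ ∞ c₁) (h₂ : ContDiff ℝ ∞ c₂)
    (hlt : ∀ x, c₁ x < c₂ x) (hbox : HasBoxes c₁ c₂) (hu : ∑ j, u j ^ 2 = 1) :
    contoursMeeting (projX m c₁ c₂) (critX m c₁ c₂) = toReeb hlt hu '' tangencies c₁ c₂ := by
  ext y
  constructor
  · rintro ⟨p, hp, rfl⟩
    exact ⟨toStrip hlt p, isTangency_of_mem_critX h₁ h₂ hlt hp, Quotient.sound
      (contour_lift_toStrip h₁.continuous h₂.continuous hlt hbox hu p)⟩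
  · rintro ⟨p, hp, rfl⟩
    exact ⟨lift hlt hu p, mem_critX_of_isTangency
      (h₁.differentiable (by simp)) (h₂.differentiable (by simp)) hlt hp, rfl⟩

end Contours

section IsolatedContours

theorem isClosed_connectedComponentIn {X : Type*} [TopologicalSpace X] {F : Set X}
    (hF : IsClosed F) (x : X) : IsClosed (connectedComponentIn F x) := by
  by_cases hx : x ∈ F
  · refine isClosed_of_closure_subset
      (isPreconnected_connectedComponentIn.closure.subset_connectedComponentIn
        (subset_closure (mem_connectedComponentIn hx)) ?_)
    exact closure_minimal (connectedComponentIn_subset F x) hF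
  · rw [connectedComponentIn_eq_empty hx]
    exact isClosed_empty

/-- The contour of `f` through `x` is compact, and no other contours of the same level and no points
of `S` at other levels accumulate at `x`. For `S` the critical set of `f`, this is what remains
local in the neighbourhood condition. -/
structure IsIsolatedContour {X : Type*} [TopologicalSpace X] (f : X → ℝ) (S : Set X) (x : X) :
    Prop where
  isCompact : IsCompact (contour f x)
  eventually_contour_eq : ∀ᶠ y in 𝓝 x, f y = f x → contour f y = contour f x
  eventually_level_eq : ∀ᶠ y in 𝓝 x, y ∈ S → f y = f x

theorem NeighbourhoodCondition.isIsolatedContour {X : Type*} [TopologicalSpace X] {f : X → ℝ}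
    {S : Set X} {q₁ q₂ : ℝ} (hf : Continuous f) (h : NeighbourhoodCondition f S q₁ q₂) {x : X}
    (hx : f x = q₁ ∨ f x = q₂) : IsIsolatedContour f S x := by
  obtain ⟨N, hN, hdisj⟩ := h
  obtain ⟨hNx, hcomp, -, -, -, hS⟩ := hN _ ⟨x, hx, rfl⟩
  have hNx' : N (contour f x) ∈ 𝓝 x := mem_nhdsSet_iff_forall.1 hNx x (mem_contour f x)
  refine ⟨hcomp.of_isClosed_subset (isClosed_connectedComponentIn (isClosed_singleton.preimage hf)
    x) (subset_of_mem_nhdsSet hNx), ?_, ?_⟩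
  · filter_upwards [hNx'] with y hy hyx
    have hy' : f y = q₁ ∨ f y = q₂ := hyx ▸ hx
    by_contra hne
    exact disjoint_left.1 (hdisj _ _ ⟨y, hy', rfl⟩ ⟨x, hx, rfl⟩ hne)
      (subset_of_mem_nhdsSet (hN _ ⟨y, hy', rfl⟩).1 (mem_contour f y)) hy
  · filter_upwards [hNx'] with y hy hyS
    by_contra hne
    exact disjoint_left.1 hS ⟨hy, fun hyx => hne (level_eq_of_mem_contour hyx)⟩ hyS

end IsolatedContours

section Boxes

theorem exists_Icc_inter_ordConnected {A : Set ℝ} {x : ℝ} (hx : x ∈ A)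
    (hcomp : IsCompact (connectedComponentIn A x))
    (hiso : ∀ y ∈ A, ∀ᶠ z in 𝓝 y, z ∈ A → uIcc y z ⊆ A) :
    ∃ a b, x ∈ Ioo a b ∧ a ∉ A ∧ b ∉ A ∧ (Icc a b ∩ A).OrdConnected := by
  set C := connectedComponentIn A x with hC
  have hCA : C ⊆ A := connectedComponentIn_subset A x
  have hconn : IsConnected C := isConnected_connectedComponentIn_iff.2 hx
  have hnear : ∀ y ∈ C, ∀ᶠ z in 𝓝 y, z ∈ A → z ∈ C := fun y hy => by
    filter_upwards [hiso y (hCA hy)] with z hz hzA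
    rw [hC, connectedComponentIn_eq hy]
    exact isPreconnected_uIcc.subset_connectedComponentIn left_mem_uIcc (hz hzA) right_mem_uIcc
  obtain ⟨a, haC, ha⟩ := mem_nhdsLE_iff_exists_Icc_subset.1
    (nhdsWithin_le_nhds (hnear _ (hcomp.sInf_mem hconn.nonempty)))
  obtain ⟨b, hbC, hb⟩ := mem_nhdsGE_iff_exists_Icc_subset.1
    (nhdsWithin_le_nhds (hnear _ (hcomp.sSup_mem hconn.nonempty)))
  have hIcc : C = Icc (sInf C) (sSup C) := eq_Icc_of_connected_compact hconn hcomp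
  have hinter : Icc a b ∩ A = C := by
    refine Subset.antisymm (fun z hz => ?_) fun z hz => ⟨?_, hCA hz⟩
    · rcases le_total z (sInf C) with h | h
      · exact ha ⟨hz.1.1, h⟩ hz.2
      rcases le_total (sSup C) z with h' | h'
      · exact hb ⟨h', hz.1.2⟩ hz.2
      · exact hIcc ▸ ⟨h, h'⟩
    · rw [hIcc] at hz
      exact ⟨haC.le.trans hz.1, hz.2.trans hbC.le⟩
  have hxIcc : x ∈ Icc (sInf C) (sSup C) := hIcc ▸ mem_connectedComponentIn hx
  refine ⟨a, b, ⟨haC.trans_le hxIcc.1, hxIcc.2.trans_lt hbC⟩, fun haA => ?_, fun hbA => ?_,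
    hinter ▸ hconn.isPreconnected.ordConnected⟩
  · have : a ∈ C := ha ⟨le_rfl, haC.le⟩ haA
    exact haC.not_ge (hIcc ▸ this : a ∈ Icc _ _).1
  · have : b ∈ C := hb ⟨hbC.le, le_rfl⟩ hbA
    exact hbC.not_ge (hIcc ▸ this : b ∈ Icc _ _).2

variable {c₁ c₂ : ℝ → ℝ}

theorem hasBoxAt_of_isCompact (h₁ : Continuous c₁) (h₂ : Continuous c₂)
    (hlt : ∀ x, c₁ x < c₂ x) {t x₀ : ℝ} (hx₀ : x₀ ∈ slice c₁ c₂ t)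
    (hcomp : IsCompact (connectedComponentIn (slice c₁ c₂ t) x₀))
    (hiso : ∀ y ∈ slice c₁ c₂ t, ∀ᶠ z in 𝓝 y, z ∈ slice c₁ c₂ t → uIcc y z ⊆ slice c₁ c₂ t)
    (htan : ∀ y ∈ slice c₁ c₂ t, ∀ᶠ p : ℝ × ℝ in 𝓝 (t, y),
      IsTangency c₁ c₂ p.1 p.2 → p.1 = t) : HasBoxAt c₁ c₂ t x₀ := by
  obtain ⟨a, b, hab, ha, hb, hconv⟩ := exists_Icc_inter_ordConnected hx₀ hcomp hiso
  refine ⟨a, b, hab, ha, hb, hconv,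
    isCompact_Icc.eventually_forall_of_forall_eventually fun x _ => ?_⟩
  by_cases hx : x ∈ slice c₁ c₂ t
  · exact htan x hx
  · have hxs : (t, x) ∉ strip c₁ c₂ := hx
    filter_upwards [(isClosed_strip h₁ h₂).isOpen_compl.mem_nhds hxs] with p hp hpt
    exact absurd (hpt.mem_slice hlt) hp

section LimitLevels

variable {m : ℕ} {u : Fin (m - 1) → ℝ}

theorem eventually_nhds_of_eventually_lift (h₁ : Continuous c₁) (h₂ : Continuous c₂)
    (hlt : ∀ x, c₁ x < c₂ x) (hu : ∑ j, u j ^ 2 = 1) {p : strip c₁ c₂}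
    {P : manifoldX m c₁ c₂ → Prop} (h : ∀ᶠ y in 𝓝 (lift hlt hu p), P y) :
    ∀ᶠ r in 𝓝 p.1, ∀ hr : r ∈ strip c₁ c₂, P (lift hlt hu ⟨r, hr⟩) := by
  have hp := (continuous_lift h₁ h₂ hlt hu).continuousAt.eventually h
  rw [nhds_subtype_eq_comap, eventually_comap] at hp
  exact hp.mono fun r hr hrs => hr ⟨r, hrs⟩ rfl

theorem isCompact_connectedComponentIn_slice (h₁ : Continuous c₁) (h₂ : Continuous c₂)
    (hlt : ∀ x, c₁ x < c₂ x) (hu : ∑ j, u j ^ 2 = 1) {p : strip c₁ c₂}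
    (hK : IsCompact (contour (projX m c₁ c₂) (lift hlt hu p))) :
    IsCompact (connectedComponentIn (slice c₁ c₂ p.1.1) p.1.2) := by
  have himage := hK.image (by fun_prop : Continuous fun r : manifoldX m c₁ c₂ => r.1.2.1)
  refine himage.of_isClosed_subset
    (isClosed_connectedComponentIn (isClosed_slice h₁ h₂ _) _) fun x hx => ?_
  have hp : p.1.2 ∈ slice c₁ c₂ p.1.1 := p.2
  have hsub : uIcc p.1.2 x ⊆ slice c₁ c₂ p.1.1 :=
    (isPreconnected_connectedComponentIn.ordConnected.uIcc_subset
      (mem_connectedComponentIn hp) hx).trans (connectedComponentIn_subset _ _)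
  refine ⟨lift hlt hu ⟨(p.1.1, x), hsub right_mem_uIcc⟩, ?_, rfl⟩
  rw [contour_lift_eq h₁ h₂ hlt hu (p := p) (q := ⟨(p.1.1, x), hsub right_mem_uIcc⟩) rfl hsub]
  exact mem_contour _ _

theorem hasBoxAt_of_isIsolatedContour (h₁ : ContDiff ℝ 1 c₁) (h₂ : ContDiff ℝ 1 c₂)
    (hlt : ∀ x, c₁ x < c₂ x) (hu : ∑ j, u j ^ 2 = 1) {t : ℝ}
    (hiso : ∀ p, projX m c₁ c₂ p = t → IsIsolatedContour (projX m c₁ c₂) (critX m c₁ c₂) p)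
    {x₀ : ℝ} (hx₀ : x₀ ∈ slice c₁ c₂ t) : HasBoxAt c₁ c₂ t x₀ := by
  have hc₁ := h₁.continuous
  have hc₂ := h₂.continuous
  refine hasBoxAt_of_isCompact hc₁ hc₂ hlt hx₀ (isCompact_connectedComponentIn_slice hc₁ hc₂ hlt hu
    (p := ⟨(t, x₀), hx₀⟩) (hiso _ rfl).isCompact) (fun y hy => ?_) fun y hy => ?_
  · have hlift := eventually_nhds_of_eventually_lift hc₁ hc₂ hlt hu
      (hiso (lift hlt hu ⟨(t, y), hy⟩) rfl).eventually_contour_eq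
    filter_upwards [((by fun_prop : Continuous fun z : ℝ => (t, z)).tendsto y).eventually hlift]
      with z hz hzs
    exact (uIcc_subset_of_contour_eq hlt (hz hzs rfl).symm).2
  · filter_upwards [eventually_nhds_of_eventually_lift hc₁ hc₂ hlt hu
      (hiso (lift hlt hu ⟨(t, y), hy⟩) rfl).eventually_level_eq] with r hr hrt
    exact hr (hrt.mem_slice hlt) (mem_critX_of_isTangency (h₁.differentiable one_ne_zero)
      (h₂.differentiable one_ne_zero) hlt hrt)

end LimitLevels

section CriticalValues

theorem eventually_eq_of_isTangency {q₁ q₂ t : ℝ} (ht : t ∈ ({q₁, q₂}ᶜ : Set ℝ))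
    (hclosed : IsClosed (criticalValuesOff c₁ c₂ q₁ q₂))
    (hdiscrete : DiscreteTopology (criticalValuesOff c₁ c₂ q₁ q₂)) :
    ∀ᶠ s in 𝓝 t, ∀ x, IsTangency c₁ c₂ s x → s = t := by
  have hV : ∀ᶠ r in 𝓝 (⟨t, ht⟩ : ({q₁, q₂}ᶜ : Set ℝ)),
      r ∈ criticalValuesOff c₁ c₂ q₁ q₂ → r = ⟨t, ht⟩ := by
    by_cases htV : (⟨t, ht⟩ : ({q₁, q₂}ᶜ : Set ℝ)) ∈ criticalValuesOff c₁ c₂ q₁ q₂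
    · obtain ⟨U, hU, hUV⟩ := discreteTopology_subtype_iff'.1 hdiscrete _ htV
      filter_upwards [hU.mem_nhds (hUV.ge rfl).1] with r hr hrV
      exact hUV.le ⟨hr, hrV⟩
    · filter_upwards [hclosed.isOpen_compl.mem_nhds htV] with r hr hrV
      exact absurd hrV hr
  rw [nhds_subtype_eq_comap, eventually_comap] at hV
  have hopen : IsOpen ({q₁, q₂}ᶜ : Set ℝ) := (toFinite _).isClosed.isOpen_compl
  filter_upwards [hV, hopen.mem_nhds ht] with s hs hsq x hx
  refine congrArg Subtype.val (hs ⟨s, hsq⟩ rfl ?_)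
  exact hx.imp (fun h => ⟨x, h.2, h.1⟩) fun h => ⟨x, h.2, h.1⟩

theorem forall_mem_uIcc_le {c : ℝ → ℝ} (hc : Continuous c) {t v w : ℝ} (hv : c v ≤ t)
    (hw : c w ≤ t) (hcrit : ∀ x ∈ uIcc v w, deriv c x = 0 → c x ≤ t) :
    ∀ x ∈ uIcc v w, c x ≤ t := by
  obtain ⟨z, hz, hmax⟩ :=
    isCompact_uIcc.exists_isMaxOn nonempty_uIcc (hc.continuousOn (s := uIcc v w))
  suffices hzt : c z ≤ t from fun x hx => (hmax hx).trans hzt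
  by_contra hlt
  have hzv : z ≠ v := by rintro rfl; exact hlt hv
  have hzw : z ≠ w := by rintro rfl; exact hlt hw
  have hnhds : uIcc v w ∈ 𝓝 z := by
    rcases le_total v w with h | h
    · rw [uIcc_of_le h] at hz ⊢
      exact Icc_mem_nhds (hz.1.lt_of_ne' hzv) (hz.2.lt_of_ne hzw)
    · rw [uIcc_of_ge h] at hz ⊢
      exact Icc_mem_nhds (hz.1.lt_of_ne' hzw) (hz.2.lt_of_ne hzv)
  exact hlt (hcrit z hz (hmax.isLocalMax hnhds).deriv_eq_zero)

theorem eventually_forall_mem_uIcc_le {c : ℝ → ℝ} (hc : Continuous c) {t v : ℝ}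
    (hcrit : ∀ᶠ s in 𝓝 t, ∀ x, c x = s → deriv c x = 0 → s = t) (hv : c v ≤ t) :
    ∀ᶠ w in 𝓝 v, c w ≤ t → ∀ x ∈ uIcc v w, c x ≤ t := by
  have hev : ∀ᶠ x in 𝓝 v, deriv c x = 0 → c x ≤ t := by
    rcases hv.lt_or_eq with hlt | rfl
    · filter_upwards [hc.continuousAt.eventually (gt_mem_nhds hlt)] with x hx _
      exact hx.le
    · filter_upwards [hc.continuousAt.eventually hcrit] with x hx hd
      exact (hx x rfl hd).le
  filter_upwards [(tendsto_const_nhds.uIcc tendsto_id).eventually hev.smallSets] with w hw hwt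
  exact forall_mem_uIcc_le hc hv hwt hw

theorem eventually_uIcc_subset_slice (h₁ : Continuous c₁) (h₂ : Continuous c₂) {t v : ℝ}
    (htan : ∀ᶠ s in 𝓝 t, ∀ x, IsTangency c₁ c₂ s x → s = t) (hv : v ∈ slice c₁ c₂ t) :
    ∀ᶠ w in 𝓝 v, w ∈ slice c₁ c₂ t → uIcc v w ⊆ slice c₁ c₂ t := by
  have hcrit₁ : ∀ᶠ s in 𝓝 t, ∀ x, c₁ x = s → deriv c₁ x = 0 → s = t :=
    htan.mono fun s hs x hx hd => hs x (Or.inl ⟨hx, hd⟩)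
  have hcrit₂ : ∀ᶠ s in 𝓝 (-t), ∀ x, (-c₂) x = s → deriv (-c₂) x = 0 → s = -t := by
    filter_upwards [(continuous_neg.tendsto (-t)).eventually ((neg_neg t).symm ▸ htan)]
      with s hs x hx hd
    rw [deriv.neg, neg_eq_zero] at hd
    exact neg_inj.1 (hs x (Or.inr ⟨neg_eq_iff_eq_neg.1 hx, hd⟩))
  filter_upwards [eventually_forall_mem_uIcc_le h₁ hcrit₁ hv.1,
    eventually_forall_mem_uIcc_le h₂.neg hcrit₂ (neg_le_neg hv.2)] with w hw₁ hw₂ hw x hx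
  exact ⟨hw₁ hw.1 x hx, neg_le_neg_iff.1 (hw₂ (neg_le_neg hw.2) x hx)⟩

theorem eventually_notMem_slice_of_tendsto {l : Filter ℝ} {q t : ℝ} (hq₁ : Tendsto c₁ l (𝓝 q))
    (hq₂ : Tendsto c₂ l (𝓝 q)) (ht : t ≠ q) : ∀ᶠ x in l, x ∉ slice c₁ c₂ t := by
  rcases ht.lt_or_gt with h | h
  · exact (hq₁.eventually (lt_mem_nhds h)).mono fun x hx hxs => hx.not_ge hxs.1
  · exact (hq₂.eventually (gt_mem_nhds h)).mono fun x hx hxs => hx.not_ge hxs.2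

theorem isCompact_slice (h₁ : Continuous c₁) (h₂ : Continuous c₂) {q₁ q₂ t : ℝ}
    (hbot₁ : Tendsto c₁ atBot (𝓝 q₁)) (hbot₂ : Tendsto c₂ atBot (𝓝 q₁))
    (htop₁ : Tendsto c₁ atTop (𝓝 q₂)) (htop₂ : Tendsto c₂ atTop (𝓝 q₂))
    (ht₁ : t ≠ q₁) (ht₂ : t ≠ q₂) : IsCompact (slice c₁ c₂ t) := by
  have hev : ∀ᶠ x in cocompact ℝ, x ∉ slice c₁ c₂ t := by
    rw [cocompact_eq_atBot_atTop]
    exact eventually_sup.2 ⟨eventually_notMem_slice_of_tendsto hbot₁ hbot₂ ht₁,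
      eventually_notMem_slice_of_tendsto htop₁ htop₂ ht₂⟩
  obtain ⟨K, hK, hKs⟩ := mem_cocompact.1 hev
  exact hK.of_isClosed_subset (isClosed_slice h₁ h₂ t) (compl_subset_compl.1 hKs)

end CriticalValues

theorem hasBoxes {m : ℕ} {u : Fin (m - 1) → ℝ} (h₁ : ContDiff ℝ 1 c₁) (h₂ : ContDiff ℝ 1 c₂)
    (hlt : ∀ x, c₁ x < c₂ x) (hu : ∑ j, u j ^ 2 = 1) {q₁ q₂ : ℝ}
    (hclosed : IsClosed (criticalValuesOff c₁ c₂ q₁ q₂))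
    (hdiscrete : DiscreteTopology (criticalValuesOff c₁ c₂ q₁ q₂))
    (hbot₁ : Tendsto c₁ atBot (𝓝 q₁)) (hbot₂ : Tendsto c₂ atBot (𝓝 q₁))
    (htop₁ : Tendsto c₁ atTop (𝓝 q₂)) (htop₂ : Tendsto c₂ atTop (𝓝 q₂))
    (hiso : ∀ p, projX m c₁ c₂ p = q₁ ∨ projX m c₁ c₂ p = q₂ →
      IsIsolatedContour (projX m c₁ c₂) (critX m c₁ c₂) p) : HasBoxes c₁ c₂ := by
  intro t x₀ hx₀
  by_cases ht : t = q₁ ∨ t = q₂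
  · exact hasBoxAt_of_isIsolatedContour h₁ h₂ hlt hu (fun p hp => hiso p (hp ▸ ht)) hx₀
  · have hc₁ := h₁.continuous
    have hc₂ := h₂.continuous
    have htan := eventually_eq_of_isTangency (t := t) ht hclosed hdiscrete
    rw [not_or] at ht
    refine hasBoxAt_of_isCompact hc₁ hc₂ hlt hx₀ ?_
      (fun y hy => eventually_uIcc_subset_slice hc₁ hc₂ htan hy)
      fun y _ => ((continuous_fst.tendsto (t, y)).eventually htan).mono fun p hp => hp p.2
    exact (isCompact_slice hc₁ hc₂ hbot₁ hbot₂ htop₁ htop₂ ht.1 ht.2).of_isClosed_subset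
      (isClosed_connectedComponentIn (isClosed_slice hc₁ hc₂ t) x₀)
      (connectedComponentIn_subset _ _)

end Boxes

section Conditions

variable {c c₁ c₂ : ℝ → ℝ} {q : ℝ}

theorem isBounded_range_of_tendsto (hc : Continuous c) {q₁ q₂ : ℝ} (hbot : Tendsto c atBot (𝓝 q₁))
    (htop : Tendsto c atTop (𝓝 q₂)) : Bornology.IsBounded (range c) := by
  obtain ⟨a, ha⟩ := eventually_atBot.1 (hbot.eventually (Metric.ball_mem_nhds q₁ one_pos))
  obtain ⟨b, hb⟩ := eventually_atTop.1 (htop.eventually (Metric.ball_mem_nhds q₂ one_pos))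
  have hbounded : Bornology.IsBounded (Metric.ball q₁ 1 ∪ (Metric.ball q₂ 1 ∪ c '' Icc a b)) :=
    Metric.isBounded_ball.union (Metric.isBounded_ball.union (isCompact_Icc.image hc).isBounded)
  refine hbounded.subset (range_subset_iff.2 fun x => ?_)
  rcases le_total x a with h | h
  · exact Or.inl (ha x h)
  rcases le_total b x with h' | h'
  · exact Or.inr (Or.inl (hb x h'))
  · exact Or.inr (Or.inr ⟨x, ⟨h, h'⟩, rfl⟩)

theorem bddAbove_criticalSet_iff : BddAbove (criticalSet c) ↔ ∀ᶠ x in atTop, deriv c x ≠ 0 := by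
  rw [eventually_atTop]
  constructor
  · rintro ⟨b, hb⟩
    exact ⟨b + 1, fun x hx hd => by linarith [hb hd]⟩
  · rintro ⟨b, hb⟩
    exact ⟨b, fun x hd => le_of_not_ge fun hx => hb x hx hd⟩

theorem eventually_lt_of_strictAntiOn_Ici {b : ℝ} (h : StrictAntiOn c (Ici b))
    (hq : Tendsto c atTop (𝓝 q)) : ∀ᶠ x in atTop, q < c x := by
  filter_upwards [eventually_ge_atTop b] with x hx
  have hx' : b ≤ x + 1 := by linarith
  refine (le_of_tendsto hq ?_).trans_lt (h hx hx' (lt_add_one x))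
  filter_upwards [eventually_ge_atTop (x + 1)] with y hy
  exact h.antitoneOn hx' (hx'.trans hy) hy

theorem strictMonoOn_or_strictAntiOn {S : Set ℝ} (hS : Convex ℝ S) (hc : Differentiable ℝ c)
    (h : ∀ x ∈ S, deriv c x ≠ 0) : StrictMonoOn c S ∨ StrictAntiOn c S := by
  rcases hasDerivWithinAt_forall_lt_or_forall_gt_of_forall_ne hS
    (fun x _ => (hc x).hasDerivAt.hasDerivWithinAt) h with h' | h'
  · exact Or.inr (strictAntiOn_of_deriv_neg hS hc.continuous.continuousOn
      fun x hx => h' x (interior_subset hx))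
  · exact Or.inl (strictMonoOn_of_deriv_pos hS hc.continuous.continuousOn
      fun x hx => h' x (interior_subset hx))

theorem eventually_gt_of_not_strictAntiOn_Ici (hc : Differentiable ℝ c)
    (hd : ∀ᶠ x in atTop, deriv c x ≠ 0) (h : ∀ b, ¬ StrictAntiOn c (Ici b))
    (hq : Tendsto c atTop (𝓝 q)) : ∀ᶠ x in atTop, c x < q := by
  obtain ⟨b, hb⟩ := eventually_atTop.1 hd
  have hmono := (strictMonoOn_or_strictAntiOn (convex_Ici b) hc hb).resolve_right (h b)
  exact (eventually_lt_of_strictAntiOn_Ici hmono.neg hq.neg).mono fun _ => neg_lt_neg_iff.1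

theorem hasRegularEnd_atTop_iff (h₁ : Differentiable ℝ c₁) (h₂ : Differentiable ℝ c₂)
    (hq₁ : Tendsto c₁ atTop (𝓝 q)) (hq₂ : Tendsto c₂ atTop (𝓝 q)) :
    HasRegularEnd c₁ c₂ atTop q ↔ BddAbove (criticalSet c₁) ∧ BddAbove (criticalSet c₂) ∧
      ((∀ b, ¬ StrictAntiOn c₂ (Ici b)) ∨ ∀ b, ¬ StrictAntiOn (-c₁) (Ici b)) := by
  rw [HasRegularEnd, eventually_and, eventually_and, bddAbove_criticalSet_iff,
    bddAbove_criticalSet_iff]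
  refine and_congr_right fun hd₁ => and_congr_right fun hd₂ => ⟨fun hout => ?_, ?_⟩
  · by_contra! hcon
    obtain ⟨⟨b, hb⟩, b', hb'⟩ := hcon
    obtain ⟨x, hx, hx₂, hx₁⟩ := (hout.and ((eventually_lt_of_strictAntiOn_Ici hb hq₂).and
      (eventually_lt_of_strictAntiOn_Ici hb' hq₁.neg))).exists
    exact hx ⟨(neg_lt_neg_iff.1 hx₁).le, hx₂.le⟩
  · rintro (hcon | hcon)
    · exact (eventually_gt_of_not_strictAntiOn_Ici h₂ hd₂ hcon hq₂).mono
        fun x hx hxs => hx.not_ge hxs.2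
    · have hd₁' : ∀ᶠ x in atTop, deriv (-c₁) x ≠ 0 := hd₁.mono fun x hx => by
        rwa [deriv.neg, neg_ne_zero]
      exact (eventually_gt_of_not_strictAntiOn_Ici h₁.neg hd₁' hcon hq₁.neg).mono
        fun x hx hxs => (neg_lt_neg_iff.1 hx).not_ge hxs.1

theorem criticalSet_comp_neg : criticalSet (fun x => c (-x)) = -criticalSet c := by
  ext x
  simp only [criticalSet, mem_ofPred_eq, Set.mem_neg, deriv_comp_neg, neg_eq_zero]

theorem forall_not_strictAntiOn_comp_neg_Ici_iff :
    (∀ b, ¬ StrictAntiOn (fun x => c (-x)) (Ici b)) ↔ ∀ b, ¬ StrictMonoOn c (Iic b) := by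
  refine neg_surjective.forall.trans (forall_congr' fun b => not_congr ⟨fun h x hx y hy hxy => ?_,
    fun h x hx y hy hxy => ?_⟩)
  · simpa using h (neg_le_neg hy : -b ≤ -y) (neg_le_neg hx : -b ≤ -x) (neg_lt_neg hxy)
  · exact h (neg_le.1 hy : -y ≤ b) (neg_le.1 hx : -x ≤ b) (neg_lt_neg hxy)

theorem hasRegularEnd_comp_neg_atTop_iff :
    HasRegularEnd (fun x => c₁ (-x)) (fun x => c₂ (-x)) atTop q ↔
      HasRegularEnd c₁ c₂ atBot q := by
  rw [HasRegularEnd, HasRegularEnd, ← map_neg_atTop, eventually_map]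
  simp only [deriv_comp_neg, ne_eq, neg_eq_zero, slice, mem_ofPred_eq]

theorem hasRegularEnd_atBot_iff (h₁ : Differentiable ℝ c₁) (h₂ : Differentiable ℝ c₂)
    (hq₁ : Tendsto c₁ atBot (𝓝 q)) (hq₂ : Tendsto c₂ atBot (𝓝 q)) :
    HasRegularEnd c₁ c₂ atBot q ↔ BddBelow (criticalSet c₁) ∧ BddBelow (criticalSet c₂) ∧
      ((∀ b, ¬ StrictMonoOn c₂ (Iic b)) ∨ ∀ b, ¬ StrictMonoOn (-c₁) (Iic b)) := by
  refine hasRegularEnd_comp_neg_atTop_iff.symm.trans ((hasRegularEnd_atTop_iff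
    (h₁.comp differentiable_neg) (h₂.comp differentiable_neg) (hq₁.comp tendsto_neg_atTop_atBot)
    (hq₂.comp tendsto_neg_atTop_atBot)).trans ?_)
  rw [← bddAbove_neg, ← bddAbove_neg, ← criticalSet_comp_neg, ← criticalSet_comp_neg]
  exact and_congr_right fun _ => and_congr_right fun _ => or_congr
    forall_not_strictAntiOn_comp_neg_Ici_iff (forall_not_strictAntiOn_comp_neg_Ici_iff (c := -c₁))

theorem not_hasRegularEnd_atBot_iff (h₁ : Differentiable ℝ c₁) (h₂ : Differentiable ℝ c₂)
    (hq₁ : Tendsto c₁ atBot (𝓝 q)) (hq₂ : Tendsto c₂ atBot (𝓝 q)) :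
    ¬ HasRegularEnd c₁ c₂ atBot q ↔
      ((¬ BddBelow (criticalSet c₂) ∨ ∃ b, StrictMonoOn c₂ (Iic b)) ∨
        (BddBelow (criticalSet c₂) ∧ (∀ b, ¬ StrictMonoOn c₂ (Iic b)) ∧
          ¬ BddBelow (criticalSet c₁))) ∧
      ((¬ BddBelow (criticalSet c₁) ∨ ∃ b, StrictMonoOn (-c₁) (Iic b)) ∨
        (BddBelow (criticalSet c₁) ∧ (∀ b, ¬ StrictMonoOn (-c₁) (Iic b)) ∧
          ¬ BddBelow (criticalSet c₂))) := by
  rw [hasRegularEnd_atBot_iff h₁ h₂ hq₁ hq₂]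
  simp only [← not_exists]
  tauto

theorem not_hasRegularEnd_atTop_iff (h₁ : Differentiable ℝ c₁) (h₂ : Differentiable ℝ c₂)
    (hq₁ : Tendsto c₁ atTop (𝓝 q)) (hq₂ : Tendsto c₂ atTop (𝓝 q)) :
    ¬ HasRegularEnd c₁ c₂ atTop q ↔
      ((¬ BddAbove (criticalSet c₂) ∨ ∃ b, StrictAntiOn c₂ (Ici b)) ∨
        (BddAbove (criticalSet c₂) ∧ (∀ b, ¬ StrictAntiOn c₂ (Ici b)) ∧
          ¬ BddAbove (criticalSet c₁))) ∧
      ((¬ BddAbove (criticalSet c₁) ∨ ∃ b, StrictAntiOn (-c₁) (Ici b)) ∨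
        (BddAbove (criticalSet c₁) ∧ (∀ b, ¬ StrictAntiOn (-c₁) (Ici b)) ∧
          ¬ BddAbove (criticalSet c₂))) := by
  rw [hasRegularEnd_atTop_iff h₁ h₂ hq₁ hq₂]
  simp only [← not_exists]
  tauto

namespace IsSliceQuotient

variable {Y : Type*} [TopologicalSpace Y] {ρ : strip c₁ c₂ → Y} {f : Y → ℝ}

theorem nontrivial (h : IsSliceQuotient ρ f) (hlt : ∀ x, c₁ x < c₂ x) : Nontrivial Y :=
  ⟨ρ ⟨(c₁ 0, 0), le_rfl, (hlt 0).le⟩, ρ ⟨(c₂ 0, 0), (hlt 0).le, le_rfl⟩, fun heq =>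
    (hlt 0).ne (by simpa only [h.level] using congrArg f heq)⟩

theorem isGraphWithEnds (h : IsSliceQuotient ρ f) (h₁ : ContDiff ℝ 1 c₁) (h₂ : ContDiff ℝ 1 c₂)
    (hlt : ∀ x, c₁ x < c₂ x) (hbox : HasBoxes c₁ c₂) (hb : Bornology.IsBounded (range f))
    (hcrit : (criticalSet c₁ ∪ criticalSet c₂).Nonempty) :
    IsGraphWithEnds Y (ρ '' tangencies c₁ c₂) := by
  have := h.t2Space
  have := h.connectedSpace h₁.continuous h₂.continuous fun x => (hlt x).le
  have := h.nontrivial hlt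
  refine (h.isLevelFunction h₁ h₂ hlt hbox).isGraphWithEnds hb (Nonempty.image ρ ?_)
  rcases hcrit with ⟨x, hx | hx⟩
  · exact ⟨⟨(c₁ x, x), le_rfl, (hlt x).le⟩, Or.inl ⟨rfl, hx⟩⟩
  · exact ⟨⟨(c₂ x, x), (hlt x).le, le_rfl⟩, Or.inr ⟨rfl, hx⟩⟩

end IsSliceQuotient

end Conditions

theorem exists_sum_sq_eq_one {m : ℕ} (hm : 2 ≤ m) : ∃ u : Fin (m - 1) → ℝ, ∑ j, u j ^ 2 = 1 :=
  ⟨Pi.single ⟨0, by omega⟩ 1, by simp [Pi.single_apply, ite_pow]⟩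

end ReebStrip

open ReebStrip in
theorem theorem3_general (m : ℕ) (hm : 2 ≤ m) (c₁ c₂ : ℝ → ℝ)
    (hc₁ : ContDiff ℝ ∞ c₁) (hc₂ : ContDiff ℝ ∞ c₂) (hlt : ∀ x, c₁ x < c₂ x)
    (q₁ q₂ : ℝ)
    (hclosed : IsClosed (criticalValuesOff c₁ c₂ q₁ q₂))
    (hdiscrete : DiscreteTopology (criticalValuesOff c₁ c₂ q₁ q₂))
    (hcrit : (criticalSet c₁ ∪ criticalSet c₂).Nonempty)
    (hbot : Tendsto c₁ atBot (𝓝 q₁) ∧ Tendsto c₂ atBot (𝓝 q₁))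
    (htop : Tendsto c₁ atTop (𝓝 q₂) ∧ Tendsto c₂ atTop (𝓝 q₂))
    (hiso : ∀ p, projX m c₁ c₂ p = q₁ ∨ projX m c₁ c₂ p = q₂ →
      IsIsolatedContour (projX m c₁ c₂) (critX m c₁ c₂) p) :
    IsGraphWithEnds (ReebSpace (projX m c₁ c₂))
        (contoursMeeting (projX m c₁ c₂) (critX m c₁ c₂)) ∧
      (IsIsomorphicToGraph (ReebSpace (projX m c₁ c₂))
          (contoursMeeting (projX m c₁ c₂) (critX m c₁ c₂)) ↔
        ((¬ BddBelow (criticalSet c₂) ∨ ∃ b, StrictMonoOn c₂ (Iic b)) ∨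
          (BddBelow (criticalSet c₂) ∧ (∀ b, ¬ StrictMonoOn c₂ (Iic b)) ∧
            ¬ BddBelow (criticalSet c₁))) ∧
        ((¬ BddAbove (criticalSet c₂) ∨ ∃ b, StrictAntiOn c₂ (Ici b)) ∨
          (BddAbove (criticalSet c₂) ∧ (∀ b, ¬ StrictAntiOn c₂ (Ici b)) ∧
            ¬ BddAbove (criticalSet c₁))) ∧
        ((¬ BddBelow (criticalSet c₁) ∨ ∃ b, StrictMonoOn (-c₁) (Iic b)) ∨
          (BddBelow (criticalSet c₁) ∧ (∀ b, ¬ StrictMonoOn (-c₁) (Iic b)) ∧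
            ¬ BddBelow (criticalSet c₂))) ∧
        ((¬ BddAbove (criticalSet c₁) ∨ ∃ b, StrictAntiOn (-c₁) (Ici b)) ∨
          (BddAbove (criticalSet c₁) ∧ (∀ b, ¬ StrictAntiOn (-c₁) (Ici b)) ∧
            ¬ BddAbove (criticalSet c₂)))) := by
  have h₁ : ContDiff ℝ 1 c₁ := hc₁.of_le (by simp)
  have h₂ : ContDiff ℝ 1 c₂ := hc₂.of_le (by simp)
  obtain ⟨u, hu⟩ := exists_sum_sq_eq_one hm
  have hbox : HasBoxes c₁ c₂ := hasBoxes h₁ h₂ hlt hu hclosed hdiscrete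
    hbot.1 hbot.2 htop.1 htop.2 hiso
  have hρ := isSliceQuotient_toReeb h₁.continuous h₂.continuous hlt hbox hu
  have hb := hρ.isBounded_range (isBounded_range_of_tendsto h₁.continuous hbot.1 htop.1)
    (isBounded_range_of_tendsto h₂.continuous hbot.2 htop.2)
  have hG := hρ.isGraphWithEnds h₁ h₂ hlt hbox hb hcrit
  have := hρ.t2Space
  rw [contoursMeeting_critX hc₁ hc₂ hlt hbox hu, hG.isIsomorphicToGraph_iff,
    hρ.forall_isCompact_closure_iff (hρ.isLevelFunction h₁ h₂ hlt hbox) h₁.continuous h₂.continuous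
      (fun x => (hlt x).le) hbox hb hbot.1 hbot.2 htop.1 htop.2,
    not_hasRegularEnd_atBot_iff h₁.differentiable_one h₂.differentiable_one hbot.1 hbot.2,
    not_hasRegularEnd_atTop_iff h₁.differentiable_one h₂.differentiable_one htop.1 htop.2,
    and_and_and_comm, and_assoc]
  exact ⟨hG, Iff.rfl⟩

theorem theorem3 (m : ℕ) (hm : 2 ≤ m) (c₁ c₂ : ℝ → ℝ)
    (hc₁ : ContDiff ℝ ∞ c₁) (hc₂ : ContDiff ℝ ∞ c₂) (hlt : ∀ x, c₁ x < c₂ x)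
    (q₁ q₂ : ℝ)
    (hclosed : IsClosed (ReebStrip.criticalValuesOff c₁ c₂ q₁ q₂))
    (hdiscrete : DiscreteTopology (ReebStrip.criticalValuesOff c₁ c₂ q₁ q₂))
    (hcrit : (ReebStrip.criticalSet c₁ ∪ ReebStrip.criticalSet c₂).Nonempty)
    (hbot : Tendsto c₁ atBot (𝓝 q₁) ∧ Tendsto c₂ atBot (𝓝 q₁))
    (htop : Tendsto c₁ atTop (𝓝 q₂) ∧ Tendsto c₂ atTop (𝓝 q₂))
    (hnhds : ReebStrip.NeighbourhoodCondition (ReebStrip.projX m c₁ c₂)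
      (ReebStrip.critX m c₁ c₂) q₁ q₂) :
    ReebStrip.IsGraphWithEnds (ReebStrip.ReebSpace (ReebStrip.projX m c₁ c₂))
        (ReebStrip.contoursMeeting (ReebStrip.projX m c₁ c₂) (ReebStrip.critX m c₁ c₂)) ∧
      (ReebStrip.IsIsomorphicToGraph (ReebStrip.ReebSpace (ReebStrip.projX m c₁ c₂))
          (ReebStrip.contoursMeeting (ReebStrip.projX m c₁ c₂) (ReebStrip.critX m c₁ c₂)) ↔
        ((¬ BddBelow (ReebStrip.criticalSet c₂) ∨ ∃ b, StrictMonoOn c₂ (Iic b)) ∨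
          (BddBelow (ReebStrip.criticalSet c₂) ∧ (∀ b, ¬ StrictMonoOn c₂ (Iic b)) ∧
            ¬ BddBelow (ReebStrip.criticalSet c₁))) ∧
        ((¬ BddAbove (ReebStrip.criticalSet c₂) ∨ ∃ b, StrictAntiOn c₂ (Ici b)) ∨
          (BddAbove (ReebStrip.criticalSet c₂) ∧ (∀ b, ¬ StrictAntiOn c₂ (Ici b)) ∧
            ¬ BddAbove (ReebStrip.criticalSet c₁))) ∧
        ((¬ BddBelow (ReebStrip.criticalSet c₁) ∨ ∃ b, StrictMonoOn (-c₁) (Iic b)) ∨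
          (BddBelow (ReebStrip.criticalSet c₁) ∧ (∀ b, ¬ StrictMonoOn (-c₁) (Iic b)) ∧
            ¬ BddBelow (ReebStrip.criticalSet c₂))) ∧
        ((¬ BddAbove (ReebStrip.criticalSet c₁) ∨ ∃ b, StrictAntiOn (-c₁) (Ici b)) ∨
          (BddAbove (ReebStrip.criticalSet c₁) ∧ (∀ b, ¬ StrictAntiOn (-c₁) (Ici b)) ∧
            ¬ BddAbove (ReebStrip.criticalSet c₂)))) :=
  theorem3_general m hm c₁ c₂ hc₁ hc₂ hlt q₁ q₂ hclosed hdiscrete hcrit hbot htop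
    fun _ => hnhds.isIsolatedContour ReebStrip.continuous_projX
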